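/- **Setting.** Let $F$ be a field, let $\Gamma$ be a loop-free quiver without multiple directed edges, with vertex set $K$ (edges in both directions between two vertices are allowed), and let $n\ge 1$ be an integer. For $k,k'\in K$ write $k\to k'$ if $(k,k')$ is an edge and $(k',k)$ is not, $k\leftarrow k'$ if $k'\to k$, $k\leftrightarrows k'$ if both $(k,k')$ and $(k',k)$ are edges, and $k\not\!-\,k'$ if $k\neq k'$ and neither is an edge. Let $\sigma$ be an automorphism of $\Gamma$ with $\sigma^p=\mathrm{id}_K$ for some integer $p\geq 1$. A $K$-composition of $n$ is a finitely supported tuple $\beta=(\beta_k)_{k\in K}$ of non-negative integers with sum $n$; $K^\beta\subseteq K^n$ is the finite set of the tuples having exactly $\beta_k$ entries equal to $k$, for every $k \in K$. The quiver Hecke algebra $\mathcal R_\beta(\Gamma)$ is the unitary associative $F$-algebra with generators $e(\mathbf k)$ ($\mathbf k\in K^\beta$), $y_1,\dots,y_n$, $\psi_1,\dots,\psi_{n-1}$ and relations $$\sum_{\mathbf k\in K^\beta}e(\mathbf k)=1,\quad e(\mathbf k)e(\mathbf k')=\delta_{\mathbf k,\mathbf k'}e(\mathbf k),\quad y_ae(\mathbf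 k)=e(\mathbf k)y_a,\quad \psi_ae(\mathbf k)=e(s_a\cdot\mathbf k)\psi_a,\quad y_ay_b=y_by_a,$$ $$\psi_ay_b=y_b\psi_a\ (b\ne a,a+1),\qquad \psi_a\psi_b=\psi_b\psi_a\ (|a-b|>1),$$ $$\psi_ay_{a+1}e(\mathbf k)=(y_a\psi_a+\delta_{k_a,k_{a+1}})e(\mathbf k),\qquad y_{a+1}\psi_ae(\mathbf k)=(\psi_ay_a+\delta_{k_a,k_{a+1}})e(\mathbf k),$$ $$\psi_a^2e(\mathbf k)=\begin{cases}0&\text{if }k_a=k_{a+1},\\ e(\mathbf k)&\text{if }k_a\not\!-\,k_{a+1},\\ (y_{a+1}-y_a)e(\mathbf k)&\text{if }k_a\to k_{a+1},\\ (y_a-y_{a+1})e(\mathbf k)&\text{if }k_a\leftarrow k_{a+1},\\ (y_{a+1}-y_a)(y_a-y_{a+1})e(\mathbf k)&\text{if }k_a\leftrightarrows k_{a+1},\end{cases}$$ $$\psi_{a+1}\psi_a\psi_{a+1}e(\mathbf k)=\begin{cases}(\psi_a\psi_{a+1}\psi_a-1)e(\mathbf k)&\text{if }k_{a+2}=k_a\to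 k_{a+1},\\ (\psi_a\psi_{a+1}\psi_a+1)e(\mathbf k)&\text{if }k_{a+2}=k_a\leftarrow k_{a+1},\\ (\psi_a\psi_{a+1}\psi_a+2y_{a+1}-y_a-y_{a+2})e(\mathbf k)&\text{if }k_{a+2}=k_a\leftrightarrows k_{a+1},\\ \psi_a\psi_{a+1}\psi_ae(\mathbf k)&\text{otherwise.}\end{cases}$$ Here $s_a=(a,a+1)\in\mathfrak S_n$, and $\mathfrak S_n$ acts on $K^n$ by permuting the entries. Put $(\sigma\cdot\beta)_k=\beta_{\sigma^{-1}(k)}$ and let $\sigma$ act entrywise on $K^n$, so that $\sigma(K^\beta)=K^{\sigma\cdot\beta}$; there is an algebra homomorphism $\sigma:\mathcal R_\beta(\Gamma)\to\mathcal R_{\sigma\cdot\beta}(\Gamma)$ with $e(\mathbf k)\mapsto e(\sigma(\mathbf k))$, $y_a\mapsto y_a$, $\psi_a\mapsto\psi_a$. Let $\alpha$ be a $K$-composition of $n$, let $[\alpha]$ be its (finite) orbit under $\langle\sigma\rangle$, and put $$K^{[\alpha]}=\bigsqcup_{\beta\in[\alpha]}K^\beta,\qquad \mathcal R_{[\alpha]}(\Gamma)=\bigoplus_{\beta\in[\alpha]}\mathcal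 R_\beta(\Gamma).$$ The homomorphisms above induce an automorphism $\sigma$ of the unitary algebra $\mathcal R_{[\alpha]}(\Gamma)$; the elements $y_a,\psi_a\in\mathcal R_{[\alpha]}(\Gamma)$ are those with component $y_a$, respectively $\psi_a$, in every summand. Let $K^{[\alpha]}_\sigma$ be the set of the $\sigma$-orbits in $K^{[\alpha]}$, and put $e(\gamma)=\sum_{\mathbf k\in\gamma}e(\mathbf k)$ for $\gamma\in K^{[\alpha]}_\sigma$. For each $w\in\mathfrak S_n$ choose any reduced expression $w=s_{a_1}\cdots s_{a_r}$ and put $\psi_w=\psi_{a_1}\cdots\psi_{a_r}$. **Theorem.** For every such choice of reduced expressions, the family $$\psi_w\,y_1^{m_1}\cdots y_n^{m_n}\,e(\gamma)\qquad\bigl(w\in\mathfrak S_n,\ (m_1,\dots,m_n)\in\mathbb N^n,\ \gamma\in K^{[\alpha]}_\sigma\bigr)$$ is an $F$-basis of $\mathcal R_{[\alpha]}(\Gamma)^\sigma=\{x\in\mathcal R_{[\alpha]}(\Gamma):\sigma(x)=x\}$. -/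

import Mathlib

noncomputable section

namespace QuiverHecke

variable {K : Type*}

/-! ### Quivers without multiple edges, as digraphs -/

/-- `k → k'`: there is an edge from `k` to `k'` and none back. -/
def Arrow (Γ : Digraph K) (k k' : K) : Prop := Γ.Adj k k' ∧ ¬ Γ.Adj k' k

/-- `k ⇆ k'`: there are edges in both directions. -/
def DoubleArrow (Γ : Digraph K) (k k' : K) : Prop := Γ.Adj k k' ∧ Γ.Adj k' k

/-- There is no edge between `k` and `k'`, in either direction. -/
def NoEdge (Γ : Digraph K) (k k' : K) : Prop := ¬ Γ.Adj k k' ∧ ¬ Γ.Adj k' k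

/-- The group of automorphisms of the quiver `Γ`. -/
abbrev QuiverAut (Γ : Digraph K) := Γ.Adj ≃r Γ.Adj

/-! ### Positions, simple transpositions and reduced expressions -/

/-- For `a` indexing the simple transposition `s_a`, the position `a` (counted from `0`). -/
def pos {n : ℕ} (a : Fin (n - 1)) : Fin n := ⟨a, by omega⟩

/-- For `a` indexing the simple transposition `s_a`, the position `a + 1`. -/
def posSucc {n : ℕ} (a : Fin (n - 1)) : Fin n := ⟨a + 1, by omega⟩

/-- The simple transposition `s_a = (a, a + 1)`. -/
def simpleTransposition {n : ℕ} (a : Fin (n - 1)) : Equiv.Perm (Fin n) :=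
  Equiv.swap (pos a) (posSucc a)

/-- The word `l = (a_1, …, a_r)` is a reduced expression of `w`: one has
`w = s_{a_1} ⋯ s_{a_r}`, and no shorter word has this property. -/
def IsReducedExpression {n : ℕ} (w : Equiv.Perm (Fin n)) (l : List (Fin (n - 1))) : Prop :=
  (l.map simpleTransposition).prod = w ∧
    ∀ l' : List (Fin (n - 1)), (l'.map simpleTransposition).prod = w → l.length ≤ l'.length

/-! ### The sets `K^β` -/

/-- The set `K^β` of the `n`-tuples having, for each `x`, exactly `β x` entries equal to `x`. -/
def tuples (n : ℕ) (β : K →₀ ℕ) : Set (Fin n → K) := {k | ∀ x, {a | k a = x}.ncard = β x}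

theorem finite_tuples (n : ℕ) (β : K →₀ ℕ) : (tuples n β).Finite := by
  refine (Set.Finite.pi (ι := Fin n) (t := fun _ => (β.support : Set K))
    (fun _ => β.support.finite_toSet)).subset ?_
  intro k hk a _
  have h := hk (k a)
  have h1 : 0 < {b | k b = k a}.ncard := (Set.ncard_pos (Set.toFinite _)).2 ⟨a, rfl⟩
  rw [h] at h1
  simpa using h1.ne'

instance fintypeTuples (n : ℕ) (β : K →₀ ℕ) : Fintype (tuples n β) := (finite_tuples n β).fintype

/-- The tuple `s_a · k`. -/
def swapTuple {n : ℕ} {β : K →₀ ℕ} (a : Fin (n - 1)) (k : tuples n β) : tuples n β :=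
  ⟨fun b => k.1 (simpleTransposition a b), fun x => by
    rw [← k.2 x]
    exact Set.ncard_preimage_of_injective_subset_range (s := {b | k.1 b = x})
      (simpleTransposition a).injective (by simp [(simpleTransposition a).surjective.range_eq])⟩

/-! ### The quiver Hecke algebra at `β` -/

/-- The generators `e(k)` for `k ∈ K^β`, `y_1, …, y_n` and `ψ_1, …, ψ_{n-1}`. -/
inductive Gen (n : ℕ) (β : K →₀ ℕ)
  | e (k : tuples n β)
  | y (a : Fin n)
  | psi (a : Fin (n - 1))

section Relations

variable (F : Type*) [Field F] {n : ℕ} {β : K →₀ ℕ}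

/-- The free generator `e(k)`. -/
abbrev freeE (k : tuples n β) : FreeAlgebra F (Gen n β) := FreeAlgebra.ι F (Gen.e k)

/-- The free generator `y_a`. -/
abbrev freeY (a : Fin n) : FreeAlgebra F (Gen n β) := FreeAlgebra.ι F (Gen.y a)

/-- The free generator `ψ_a`. -/
abbrev freePsi (a : Fin (n - 1)) : FreeAlgebra F (Gen n β) := FreeAlgebra.ι F (Gen.psi a)

/-- The defining relations of the quiver Hecke algebra at `β`. In the last four relations
(the braid relations), `b` stands for `a + 1`, so that the positions `a`, `a + 1`, `a + 2` are
`pos a`, `posSucc a`, `posSucc b`. -/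
inductive Rel (Γ : Digraph K) : FreeAlgebra F (Gen n β) → FreeAlgebra F (Gen n β) → Prop
  | sum_e : Rel Γ (∑ k : tuples n β, freeE F k) 1
  | e_mul_self (k : tuples n β) : Rel Γ (freeE F k * freeE F k) (freeE F k)
  | e_mul_ne (k k' : tuples n β) (h : k ≠ k') : Rel Γ (freeE F k * freeE F k') 0
  | y_e (a : Fin n) (k : tuples n β) :
      Rel Γ (freeY F a * freeE F k) (freeE F k * freeY F a)
  | psi_e (a : Fin (n - 1)) (k : tuples n β) :
      Rel Γ (freePsi F a * freeE F k) (freeE F (swapTuple a k) * freePsi F a)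
  | y_y (a b : Fin n) : Rel Γ (freeY F a * freeY F b) (freeY F b * freeY F a)
  | psi_y (a : Fin (n - 1)) (b : Fin n) (h : b ≠ pos a) (h' : b ≠ posSucc a) :
      Rel Γ (freePsi F a * freeY F b) (freeY F b * freePsi F a)
  | psi_psi (a b : Fin (n - 1)) (h : (a : ℕ) + 1 < b ∨ (b : ℕ) + 1 < a) :
      Rel Γ (freePsi F a * freePsi F b) (freePsi F b * freePsi F a)
  | psi_y_succ_eq (a : Fin (n - 1)) (k : tuples n β) (h : k.1 (pos a) = k.1 (posSucc a)) :
      Rel Γ (freePsi F a * freeY F (posSucc a) * freeE F k)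
        ((freeY F (pos a) * freePsi F a + 1) * freeE F k)
  | psi_y_succ_ne (a : Fin (n - 1)) (k : tuples n β) (h : k.1 (pos a) ≠ k.1 (posSucc a)) :
      Rel Γ (freePsi F a * freeY F (posSucc a) * freeE F k)
        (freeY F (pos a) * freePsi F a * freeE F k)
  | y_succ_psi_eq (a : Fin (n - 1)) (k : tuples n β) (h : k.1 (pos a) = k.1 (posSucc a)) :
      Rel Γ (freeY F (posSucc a) * freePsi F a * freeE F k)
        ((freePsi F a * freeY F (pos a) + 1) * freeE F k)
  | y_succ_psi_ne (a : Fin (n - 1)) (k : tuples n β) (h : k.1 (pos a) ≠ k.1 (posSucc a)) :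
      Rel Γ (freeY F (posSucc a) * freePsi F a * freeE F k)
        (freePsi F a * freeY F (pos a) * freeE F k)
  | psi_sq_eq (a : Fin (n - 1)) (k : tuples n β) (h : k.1 (pos a) = k.1 (posSucc a)) :
      Rel Γ (freePsi F a ^ 2 * freeE F k) 0
  | psi_sq_noEdge (a : Fin (n - 1)) (k : tuples n β) (hne : k.1 (pos a) ≠ k.1 (posSucc a))
      (h : NoEdge Γ (k.1 (pos a)) (k.1 (posSucc a))) :
      Rel Γ (freePsi F a ^ 2 * freeE F k) (freeE F k)
  | psi_sq_right (a : Fin (n - 1)) (k : tuples n β)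
      (h : Arrow Γ (k.1 (pos a)) (k.1 (posSucc a))) :
      Rel Γ (freePsi F a ^ 2 * freeE F k)
        ((freeY F (posSucc a) - freeY F (pos a)) * freeE F k)
  | psi_sq_left (a : Fin (n - 1)) (k : tuples n β)
      (h : Arrow Γ (k.1 (posSucc a)) (k.1 (pos a))) :
      Rel Γ (freePsi F a ^ 2 * freeE F k)
        ((freeY F (pos a) - freeY F (posSucc a)) * freeE F k)
  | psi_sq_double (a : Fin (n - 1)) (k : tuples n β)
      (h : DoubleArrow Γ (k.1 (pos a)) (k.1 (posSucc a))) :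
      Rel Γ (freePsi F a ^ 2 * freeE F k)
        ((freeY F (posSucc a) - freeY F (pos a)) * (freeY F (pos a) - freeY F (posSucc a))
          * freeE F k)
  | braid_right (a b : Fin (n - 1)) (hab : (b : ℕ) = a + 1) (k : tuples n β)
      (h : k.1 (posSucc b) = k.1 (pos a)) (h' : Arrow Γ (k.1 (pos a)) (k.1 (posSucc a))) :
      Rel Γ (freePsi F b * freePsi F a * freePsi F b * freeE F k)
        ((freePsi F a * freePsi F b * freePsi F a - 1) * freeE F k)
  | braid_left (a b : Fin (n - 1)) (hab : (b : ℕ) = a + 1) (k : tuples n β)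
      (h : k.1 (posSucc b) = k.1 (pos a)) (h' : Arrow Γ (k.1 (posSucc a)) (k.1 (pos a))) :
      Rel Γ (freePsi F b * freePsi F a * freePsi F b * freeE F k)
        ((freePsi F a * freePsi F b * freePsi F a + 1) * freeE F k)
  | braid_double (a b : Fin (n - 1)) (hab : (b : ℕ) = a + 1) (k : tuples n β)
      (h : k.1 (posSucc b) = k.1 (pos a)) (h' : DoubleArrow Γ (k.1 (pos a)) (k.1 (posSucc a))) :
      Rel Γ (freePsi F b * freePsi F a * freePsi F b * freeE F k)
        ((freePsi F a * freePsi F b * freePsi F a + 2 * freeY F (posSucc a)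
          - freeY F (pos a) - freeY F (posSucc b)) * freeE F k)
  | braid_other (a b : Fin (n - 1)) (hab : (b : ℕ) = a + 1) (k : tuples n β)
      (h : ¬ (k.1 (posSucc b) = k.1 (pos a) ∧
        (Arrow Γ (k.1 (pos a)) (k.1 (posSucc a)) ∨ Arrow Γ (k.1 (posSucc a)) (k.1 (pos a)) ∨
          DoubleArrow Γ (k.1 (pos a)) (k.1 (posSucc a))))) :
      Rel Γ (freePsi F b * freePsi F a * freePsi F b * freeE F k)
        (freePsi F a * freePsi F b * freePsi F a * freeE F k)

end Relations

/-- The quiver Hecke algebra at `β` associated with `Γ`, over `F`. -/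
abbrev QHAlgebra (F : Type*) [Field F] (Γ : Digraph K) (n : ℕ) (β : K →₀ ℕ) :=
  RingQuot (Rel F Γ (n := n) (β := β))

section Generators

variable (F : Type*) [Field F] (Γ : Digraph K) {n : ℕ} {β : K →₀ ℕ}

/-- The quotient map from the free algebra. -/
abbrev mk : FreeAlgebra F (Gen n β) →ₐ[F] QHAlgebra F Γ n β := RingQuot.mkAlgHom F _

/-- The image in the quiver Hecke algebra at `β` of a generator. -/
def gen (g : Gen n β) : QHAlgebra F Γ n β := mk F Γ (FreeAlgebra.ι F g)

end Generators

/-! ### The homomorphism induced by an automorphism of the quiver -/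

section Sigma

variable {Γ : Digraph K} (σ : QuiverAut Γ)

/-- The `K`-composition `σ · β`, given by `(σ · β) k = β (σ⁻¹ k)`. -/
def actComp (β : K →₀ ℕ) : K →₀ ℕ := β.equivMapDomain σ.toEquiv

@[simp] theorem actComp_apply (β : K →₀ ℕ) (k : K) : actComp σ β k = β (σ⁻¹ k) := rfl

theorem actComp_mul (τ : QuiverAut Γ) (β : K →₀ ℕ) :
    actComp (σ * τ) β = actComp σ (actComp τ β) := by
  ext k; simp [RelIso.mul_apply]

/-- The map `k ↦ σ(k)` on tuples. -/
def actTuple {n : ℕ} (k : Fin n → K) : Fin n → K := fun a => σ (k a)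

theorem actTuple_mem {n : ℕ} {β : K →₀ ℕ} {k : Fin n → K} (hk : k ∈ tuples n β) :
    actTuple σ k ∈ tuples n (actComp σ β) := by
  intro x
  rw [actComp_apply, ← hk (σ⁻¹ x)]
  congr 1
  ext a
  change σ (k a) = x ↔ k a = σ⁻¹ x
  constructor
  · rintro rfl; simp
  · rintro h; simp [h]

/-- The bijection `K^β → K^{σ · β}`. The target is a variable `β'` with `β' = σ · β`. -/
def tupleEquiv {n : ℕ} {β β' : K →₀ ℕ} (h : β' = actComp σ β) : tuples n β ≃ tuples n β' where
  toFun k := ⟨actTuple σ k.1, h ▸ actTuple_mem σ k.2⟩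
  invFun k := ⟨actTuple σ⁻¹ k.1, by
    have h1 := actTuple_mem σ⁻¹ k.2
    have h2 : actComp σ⁻¹ β' = β := by
      rw [h, ← actComp_mul, inv_mul_cancel]; ext; simp
    rwa [h2] at h1⟩
  left_inv k := by ext a; simp [actTuple]
  right_inv k := by ext a; simp [actTuple]

/-- The effect of `σ` on the generators: `e(k) ↦ e(σ(k))`, `y_a ↦ y_a`, `ψ_a ↦ ψ_a`. -/
def genMap {n : ℕ} {β β' : K →₀ ℕ} (h : β' = actComp σ β) : Gen n β → Gen n β'
  | Gen.e k => Gen.e (tupleEquiv σ h k)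
  | Gen.y a => Gen.y a
  | Gen.psi a => Gen.psi a

variable (F : Type*) [Field F] {n : ℕ} {β β' : K →₀ ℕ} (h : β' = actComp σ β)

theorem adj_iff (k k' : K) : Γ.Adj (σ k) (σ k') ↔ Γ.Adj k k' := σ.map_rel_iff

theorem arrow_iff (k k' : K) : Arrow Γ (σ k) (σ k') ↔ Arrow Γ k k' := by
  simp only [Arrow, adj_iff]

theorem doubleArrow_iff (k k' : K) : DoubleArrow Γ (σ k) (σ k') ↔ DoubleArrow Γ k k' := by
  simp only [DoubleArrow, adj_iff]

theorem noEdge_iff (k k' : K) : NoEdge Γ (σ k) (σ k') ↔ NoEdge Γ k k' := by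
  simp only [NoEdge, adj_iff]

theorem tupleEquiv_apply (k : tuples n β) (a : Fin n) :
    (tupleEquiv σ h k).1 a = σ (k.1 a) := rfl

theorem tupleEquiv_swapTuple (a : Fin (n - 1)) (k : tuples n β) :
    tupleEquiv σ h (swapTuple a k) = swapTuple a (tupleEquiv σ h k) := rfl

/-- The homomorphism of free algebras induced by `genMap`. -/
def freeMap : FreeAlgebra F (Gen n β) →ₐ[F] FreeAlgebra F (Gen n β') :=
  FreeAlgebra.lift F fun g => FreeAlgebra.ι F (genMap σ h g)

theorem rel_freeMap {x z : FreeAlgebra F (Gen n β)} (hr : Rel F Γ x z) :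
    Rel F Γ (freeMap σ F h x) (freeMap σ F h z) := by
  have hinj : Function.Injective σ := σ.injective
  cases hr with
  | sum_e =>
    have : ∑ k : tuples n β, freeE F (tupleEquiv σ h k) = ∑ k : tuples n β', freeE F k :=
      (tupleEquiv σ h).sum_comp fun k => freeE F k
    simp only [freeMap, map_sum, map_one, freeE, FreeAlgebra.lift_ι_apply, genMap]
    rw [this]
    exact Rel.sum_e
  | e_mul_ne k k' hk =>
    simp only [freeMap, map_mul, map_zero, FreeAlgebra.lift_ι_apply, genMap]
    exact Rel.e_mul_ne _ _ fun hh => hk ((tupleEquiv σ h).injective hh)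
  | e_mul_self | y_e | y_y | psi_e =>
    simp only [freeMap, map_mul, FreeAlgebra.lift_ι_apply, genMap, tupleEquiv_swapTuple]
    constructor
  | _ =>
    simp only [freeMap, map_mul, map_add, map_sub, map_pow, map_one, map_zero, map_ofNat,
      FreeAlgebra.lift_ι_apply, genMap]
    first
    | exact Rel.psi_y _ _ ‹_› ‹_›
    | exact Rel.psi_psi _ _ ‹_›
    | exact Rel.psi_y_succ_eq _ _ (by simpa [tupleEquiv_apply])
    | exact Rel.psi_y_succ_ne _ _ (by simpa [tupleEquiv_apply])
    | exact Rel.y_succ_psi_eq _ _ (by simpa [tupleEquiv_apply])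
    | exact Rel.y_succ_psi_ne _ _ (by simpa [tupleEquiv_apply])
    | exact Rel.psi_sq_eq _ _ (by simpa [tupleEquiv_apply])
    | exact Rel.psi_sq_noEdge _ _ (by simpa [tupleEquiv_apply])
        (by simpa [tupleEquiv_apply, noEdge_iff])
    | exact Rel.psi_sq_right _ _ (by simpa [tupleEquiv_apply, arrow_iff])
    | exact Rel.psi_sq_left _ _ (by simpa [tupleEquiv_apply, arrow_iff])
    | exact Rel.psi_sq_double _ _ (by simpa [tupleEquiv_apply, doubleArrow_iff])
    | exact Rel.braid_right _ _ ‹_› _ (by simpa [tupleEquiv_apply])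
        (by simpa [tupleEquiv_apply, arrow_iff])
    | exact Rel.braid_left _ _ ‹_› _ (by simpa [tupleEquiv_apply])
        (by simpa [tupleEquiv_apply, arrow_iff])
    | exact Rel.braid_double _ _ ‹_› _ (by simpa [tupleEquiv_apply])
        (by simpa [tupleEquiv_apply, doubleArrow_iff])
    | exact Rel.braid_other _ _ ‹_› _ (by
        simpa only [tupleEquiv_apply, doubleArrow_iff, arrow_iff, hinj.eq_iff])

theorem rel_map {x z : FreeAlgebra F (Gen n β)} (hr : Rel F Γ x z) :
    FreeAlgebra.lift F (fun g => gen F Γ (genMap σ h g)) x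
      = FreeAlgebra.lift F (fun g => gen F Γ (genMap σ h g)) z := by
  have key : FreeAlgebra.lift F (fun g : Gen n β => gen F Γ (genMap σ h g))
      = (mk F Γ).comp (freeMap σ F h) := by
    ext g
    simp [gen, freeMap]
  rw [key]
  exact RingQuot.mkAlgHom_rel F (rel_freeMap σ F h hr)

/-- The algebra homomorphism `σ` from the quiver Hecke algebra at `β` to the one at
`β' = σ · β`, given by `e(k) ↦ e(σ(k))`, `y_a ↦ y_a`, `ψ_a ↦ ψ_a`. -/
def sigmaHom : QHAlgebra F Γ n β →ₐ[F] QHAlgebra F Γ n β' :=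
  RingQuot.liftAlgHom F ⟨FreeAlgebra.lift F (fun g => gen F Γ (genMap σ h g)),
    fun _ _ hr => rel_map σ F h hr⟩

@[simp] theorem sigmaHom_gen (g : Gen n β) :
    sigmaHom σ F h (gen F Γ g) = gen F Γ (genMap σ h g) := by
  simp [sigmaHom, gen]

end Sigma

/-! ### The algebra of an orbit of `K`-compositions -/

section Orbit

variable {Γ : Digraph K} (σ : QuiverAut Γ)

/-- The orbit `[α]` of `α` under the group generated by `σ`. -/
def orbit (α : K →₀ ℕ) : Set (K →₀ ℕ) := {β | ∃ j : ℤ, β = actComp (σ ^ j) α}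

/-- The element `σ⁻¹ · β` of `[α]`, for `β` in `[α]`. -/
def orbitPred {α : K →₀ ℕ} (β : orbit σ α) : orbit σ α :=
  ⟨actComp σ⁻¹ β.1, by
    obtain ⟨j, hj⟩ := β.2
    exact ⟨-1 + j, by rw [hj, ← actComp_mul, zpow_add, zpow_neg_one]⟩⟩

theorem orbitPred_spec {α : K →₀ ℕ} (β : orbit σ α) :
    β.1 = actComp σ (orbitPred σ β).1 := by
  rw [orbitPred, ← actComp_mul, mul_inv_cancel]; ext; simp

/-- The set `K^{[α]}`, the union of the (disjoint) sets `K^β` for `β ∈ [α]`. -/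
def orbitTuples (n : ℕ) (α : K →₀ ℕ) : Set (Fin n → K) := ⋃ β ∈ orbit σ α, tuples n β

/-- The set `K^{[α]}` is finite if `σ` has finite order. -/
theorem finite_orbitTuples (n : ℕ) (α : K →₀ ℕ) {p : ℕ} (hp : 0 < p) (hσ : σ ^ p = 1) :
    (orbitTuples σ n α).Finite := by
  refine Set.Finite.biUnion ?_ fun β _ => finite_tuples n β
  refine (Set.finite_range fun j : Fin p => actComp (σ ^ (j : ℕ)) α).subset ?_
  rintro β ⟨j, rfl⟩
  have hp' : (p : ℤ) ≠ 0 := by exact_mod_cast hp.ne'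
  have h0 := Int.emod_nonneg j hp'
  have h1 := Int.emod_lt_of_pos j (by exact_mod_cast hp : (0 : ℤ) < p)
  refine ⟨⟨(j % p).toNat, by omega⟩, ?_⟩
  have : σ ^ j = σ ^ (j % p).toNat := by
    conv_lhs => rw [← Int.emod_add_mul_ediv j p]
    rw [zpow_add, zpow_mul, zpow_natCast, hσ, one_zpow, mul_one, ← zpow_natCast,
      Int.toNat_of_nonneg h0]
  simp only [this]

/-- The map `σ : K^{[α]} → K^{[α]}`. -/
def actOrbitTuple {n : ℕ} {α : K →₀ ℕ} (k : orbitTuples σ n α) : orbitTuples σ n α :=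
  ⟨actTuple σ k.1, by
    obtain ⟨β, ⟨j, hj⟩, hk⟩ := Set.mem_iUnion₂.1 k.2
    exact Set.mem_iUnion₂.2 ⟨actComp σ β, ⟨1 + j, by
      rw [hj, ← actComp_mul, zpow_add, zpow_one]⟩, actTuple_mem σ hk⟩⟩

/-- The quotient of `K^{[α]}` by the equivalence relation generated by `k ∼ σ(k)`, that is, the
set of the `σ`-orbits of `K^{[α]}`. -/
def TupleClass (n : ℕ) (α : K →₀ ℕ) : Type _ :=
  Quot fun k k' : orbitTuples σ n α => k' = actOrbitTuple σ k

variable (F : Type*) [Field F] (n : ℕ) (α : K →₀ ℕ)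

/-- The algebra `R_{[α]}(Γ)`, the direct sum of the algebras `R_β(Γ)` for `β ∈ [α]`. The orbit
`[α]` is finite when `σ` has finite order, so that the direct sum is the product. -/
abbrev OrbitAlgebra := ∀ β : orbit σ α, QHAlgebra F Γ n β.1

/-- The endomorphism `σ` of `R_{[α]}(Γ)`, which sends each summand `R_β(Γ)` to
`R_{σ · β}(Γ)` by `sigmaHom`. -/
def orbitSigma : OrbitAlgebra σ F n α →ₐ[F] OrbitAlgebra σ F n α :=
  AlgHom.pi fun β =>
    (sigmaHom σ F (orbitPred_spec σ β)).comp (Pi.evalAlgHom F _ (orbitPred σ β))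

/-- The subspace of the `σ`-fixed points of `R_{[α]}(Γ)`. -/
def fixedPoints : Submodule F (OrbitAlgebra σ F n α) where
  carrier := {x | orbitSigma σ F n α x = x}
  add_mem' hx hy := by
    simp only [Set.mem_ofPred_eq] at *
    rw [map_add, hx, hy]
  zero_mem' := map_zero _
  smul_mem' c x hx := by
    simp only [Set.mem_ofPred_eq] at *
    rw [map_smul, hx]

variable {n α}

/-- The element `y_a` of `R_{[α]}(Γ)`. -/
def orbY (a : Fin n) : OrbitAlgebra σ F n α := fun _ => gen F Γ (Gen.y a)

/-- The element `ψ_a` of `R_{[α]}(Γ)`. -/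
def orbPsi (a : Fin (n - 1)) : OrbitAlgebra σ F n α := fun _ => gen F Γ (Gen.psi a)

open Classical in
/-- The element `e(k)` of `R_{[α]}(Γ)`, for `k ∈ K^{[α]}`: it lies in the summand `R_β(Γ)` with
`k ∈ K^β`. -/
def orbE (k : orbitTuples σ n α) : OrbitAlgebra σ F n α := fun β =>
  if h : k.1 ∈ tuples n β.1 then gen F Γ (Gen.e ⟨k.1, h⟩) else 0

/-- The element `e(γ)`, the sum of the `e(k)` for `k ∈ γ`. -/
def orbClassE (γ : TupleClass σ n α) : OrbitAlgebra σ F n α :=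
  ∑ᶠ k : {k : orbitTuples σ n α // Quot.mk _ k = γ}, orbE σ F k.1

/-- The product `ψ_{a_1} ⋯ ψ_{a_r}` for a word `(a_1, …, a_r)`. -/
def orbPsiWord (l : List (Fin (n - 1))) : OrbitAlgebra σ F n α := (l.map (orbPsi σ F)).prod

/-- The monomial `y_1^{m_1} ⋯ y_n^{m_n}`. -/
def orbYMonomial (m : Fin n → ℕ) : OrbitAlgebra σ F n α :=
  (List.ofFn fun a => orbY σ F a ^ m a).prod

end Orbit

end QuiverHecke

end

/-!
The theorem follows from the basis theorem for a single quiver Hecke algebra `R_β`: the elements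
`ψ_w y^m e(k)` form a basis of `R_β`, whatever the choice of reduced words.

*Spanning.* Let `P` be the subalgebra generated by the `y_a` and the `e(k)`. Up to corrections in
`P`, the `ψ_a` satisfy the braid relations and have square zero, and they commute with `P` up to
replacing an element of `P` by another one (`BraidModulo`). By Matsumoto's theorem, two reduced
words of the same permutation are related by braid relations, so that their products agree modulo
products of shorter words (`BraidModulo.wordProd_sub_mem`), and a word that is not reduced gives a
combination of products of shorter words. By induction on the length, one reduced word for each
permutation suffices (`BraidModulo.shortSpan_le`).

*Independence.* Instead of Demazure operators on polynomials, the algebra acts on functions on the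
orbit of a generic point under the symmetric group. The point consists of a tuple of labels
`k₀ ∈ K^β` and of algebraically independent elements `x_1, …, x_n` of a field `L`, and the orbit is
identified with the symmetric group. Then `y_b` and `e(k)` are multiplication operators and `ψ_a` is
a combination of the translation by `s_a` and the identity, with coefficients in `L`. The relations
become identities between rational functions in at most three variables (`sqCoeff_identity`,
`braidCoeff_identity`). Applied to the function concentrated at the identity, `ψ_w` gives a nonzero
value at `w⁻¹` and otherwise only values at inverses of shorter permutations. Hence these functions
are linearly independent over `L`, and the monomials in the `x_a` are independent over `F`.

*Fixed points.* Right multiplication by `e(k)` sends `ψ_w y^m e(γ)` to `ψ_w y^m e(k)` if `k ∈ γ`,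
and to zero otherwise, so that independence follows from that in `R_β`. For a fixed point `z`,
choose a representative of each class `γ` and use the coefficients of `z e(k)` at the
representatives `k` to form a combination of the `ψ_w y^m e(γ)`. Its difference with `z` is fixed
by `σ` and killed by `e(k)` for each representative `k`, hence for all `k`, so it is zero.
-/

noncomputable section

namespace QuiverHecke

/-! ### Inversions and reduced words in the symmetric group -/

section Words

variable {n : ℕ}

/-- The permutation `s_{a_1} ⋯ s_{a_r}` attached to the word `(a_1, …, a_r)`. -/
def wordPerm (l : List (Fin (n - 1))) : Equiv.Perm (Fin n) := (l.map simpleTransposition).prod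

@[simp] theorem wordPerm_nil : wordPerm ([] : List (Fin (n - 1))) = 1 := rfl

@[simp] theorem wordPerm_cons (a : Fin (n - 1)) (l : List (Fin (n - 1))) :
    wordPerm (a :: l) = simpleTransposition a * wordPerm l := by
  simp [wordPerm]

theorem pos_lt_posSucc (a : Fin (n - 1)) : pos a < posSucc a := by
  simp [pos, posSucc, Fin.lt_def]

theorem pos_ne_posSucc (a : Fin (n - 1)) : pos a ≠ posSucc a := (pos_lt_posSucc a).ne

@[simp] theorem simpleTransposition_pos (a : Fin (n - 1)) :
    simpleTransposition a (pos a) = posSucc a := Equiv.swap_apply_left _ _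

@[simp] theorem simpleTransposition_posSucc (a : Fin (n - 1)) :
    simpleTransposition a (posSucc a) = pos a := Equiv.swap_apply_right _ _

theorem simpleTransposition_of_ne {a : Fin (n - 1)} {b : Fin n} (h : b ≠ pos a)
    (h' : b ≠ posSucc a) : simpleTransposition a b = b := Equiv.swap_apply_of_ne_of_ne h h'

@[simp] theorem simpleTransposition_inv (a : Fin (n - 1)) :
    (simpleTransposition a)⁻¹ = simpleTransposition a := Equiv.swap_inv _ _

@[simp] theorem simpleTransposition_mul_self (a : Fin (n - 1)) :
    simpleTransposition a * simpleTransposition a = 1 := Equiv.swap_mul_self _ _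

@[simp] theorem simpleTransposition_simpleTransposition (a : Fin (n - 1)) (b : Fin n) :
    simpleTransposition a (simpleTransposition a b) = b := Equiv.swap_apply_self _ _ _

@[simp] theorem simpleTransposition_mul_cancel_left (a : Fin (n - 1))
    (w : Equiv.Perm (Fin n)) : simpleTransposition a * (simpleTransposition a * w) = w := by
  rw [← mul_assoc, simpleTransposition_mul_self, one_mul]

/-- Apart from `(a, a + 1)`, the transposition `s_a` preserves the order of pairs. -/
theorem simpleTransposition_lt {a : Fin (n - 1)} {p q : Fin n} (h : p < q)
    (hne : ¬ (p = pos a ∧ q = posSucc a)) :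
    simpleTransposition a p < simpleTransposition a q := by
  simp only [simpleTransposition, Equiv.swap_apply_def]
  simp only [pos, posSucc, Fin.ext_iff, Fin.lt_def] at *
  split_ifs <;> (try dsimp only) <;> omega

theorem simpleTransposition_comm {a b : Fin (n - 1)} (hab : (a : ℕ) + 1 < b ∨ (b : ℕ) + 1 < a) :
    simpleTransposition a * simpleTransposition b
      = simpleTransposition b * simpleTransposition a := by
  refine (Equiv.Perm.Disjoint.commute ?_).eq
  rw [Equiv.Perm.disjoint_iff_eq_or_eq]
  intro c
  by_cases hc : c = pos a ∨ c = posSucc a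
  · right
    rcases hc with rfl | rfl <;>
    exact simpleTransposition_of_ne (by simp [posSucc, pos, Fin.ext_iff]; omega)
      (by simp [posSucc, pos, Fin.ext_iff]; omega)
  · left
    push Not at hc
    exact simpleTransposition_of_ne hc.1 hc.2

theorem posSucc_eq_pos {a b : Fin (n - 1)} (hab : (b : ℕ) = a + 1) : posSucc a = pos b := by
  simp [posSucc, pos, hab]

theorem simpleTransposition_braid {a b : Fin (n - 1)} (hab : (b : ℕ) = a + 1) :
    simpleTransposition b * simpleTransposition a * simpleTransposition b
      = simpleTransposition a * simpleTransposition b * simpleTransposition a := by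
  have h1 : pos a ≠ posSucc b := by simp [posSucc, pos, Fin.ext_iff]; omega
  have h2 := pos_ne_posSucc a
  have h3 := pos_ne_posSucc b
  rw [posSucc_eq_pos hab] at h2
  rw [simpleTransposition, simpleTransposition, posSucc_eq_pos hab,
    Equiv.swap_mul_swap_mul_swap h2 h1, Equiv.swap_comm (pos a) (pos b),
    Equiv.swap_comm (pos b) (posSucc b), Equiv.swap_mul_swap_mul_swap h3.symm h1.symm,
    Equiv.swap_comm]

/-- The number of inversions of `w⁻¹`, which is also the length of `w`. -/
def invNum (w : Equiv.Perm (Fin n)) : ℕ :=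
  (Finset.univ.filter fun p : Fin n × Fin n => p.1 < p.2 ∧ w⁻¹ p.2 < w⁻¹ p.1).card

@[simp] theorem invNum_one : invNum (1 : Equiv.Perm (Fin n)) = 0 := by
  simp only [invNum, Finset.card_eq_zero, Finset.filter_eq_empty_iff]
  rintro p - ⟨h, h'⟩
  exact lt_asymm h h'

theorem invNum_mul_of_lt {a : Fin (n - 1)} {w : Equiv.Perm (Fin n)}
    (h : w⁻¹ (pos a) < w⁻¹ (posSucc a)) : invNum (simpleTransposition a * w) = invNum w + 1 := by
  have hinj : Function.Injective
      (Prod.map (simpleTransposition a) (simpleTransposition a)) :=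
    (simpleTransposition a).injective.prodMap (simpleTransposition a).injective
  rw [invNum, invNum, ← Finset.card_image_of_injective
      (Finset.univ.filter fun p : Fin n × Fin n => p.1 < p.2 ∧ w⁻¹ p.2 < w⁻¹ p.1) hinj,
    ← Finset.card_insert_of_notMem (a := (pos a, posSucc a))]
  · congr 1
    ext ⟨p, q⟩
    have himg : (p, q) ∈ Finset.image (Prod.map (simpleTransposition a) (simpleTransposition a))
        (Finset.univ.filter fun p : Fin n × Fin n => p.1 < p.2 ∧ w⁻¹ p.2 < w⁻¹ p.1) ↔
        simpleTransposition a p < simpleTransposition a q ∧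
          w⁻¹ (simpleTransposition a q) < w⁻¹ (simpleTransposition a p) := by
      simp only [Finset.mem_image, Finset.mem_filter, Finset.mem_univ, true_and, Prod.exists,
        Prod.map_apply, Prod.mk.injEq]
      constructor
      · rintro ⟨p', q', hh, rfl, rfl⟩
        simpa using hh
      · intro hh
        exact ⟨_, _, hh, by simp, by simp⟩
    rw [Finset.mem_insert, himg]
    simp only [Finset.mem_filter, Finset.mem_univ, true_and, mul_inv_rev,
      simpleTransposition_inv, Equiv.Perm.mul_apply, Prod.mk.injEq]
    constructor
    · rintro ⟨h1, h2⟩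
      by_cases hc : p = pos a ∧ q = posSucc a
      · exact Or.inl hc
      · exact Or.inr ⟨simpleTransposition_lt h1 hc, h2⟩
    · rintro (⟨rfl, rfl⟩ | ⟨h1, h2⟩)
      · simpa using ⟨pos_lt_posSucc a, h⟩
      · refine ⟨?_, h2⟩
        have := simpleTransposition_lt h1 (a := a) fun hc => by
          rw [hc.1, hc.2] at h2
          exact lt_asymm h h2
        simpa using this
  · simp only [Finset.mem_image, Finset.mem_filter, Finset.mem_univ, true_and, Prod.exists,
      Prod.map_apply, Prod.mk.injEq, not_exists, not_and]
    rintro p q ⟨h1, -⟩ h2 h3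
    rw [← simpleTransposition_posSucc, EmbeddingLike.apply_eq_iff_eq] at h2
    rw [← simpleTransposition_pos, EmbeddingLike.apply_eq_iff_eq] at h3
    subst h2 h3
    exact lt_asymm h1 (pos_lt_posSucc a)

theorem invNum_mul_of_gt {a : Fin (n - 1)} {w : Equiv.Perm (Fin n)}
    (h : w⁻¹ (posSucc a) < w⁻¹ (pos a)) :
    invNum (simpleTransposition a * w) + 1 = invNum w := by
  have := invNum_mul_of_lt (a := a) (w := simpleTransposition a * w) (by simpa using h)
  simpa using this.symm

theorem inv_pos_ne (w : Equiv.Perm (Fin n)) (a : Fin (n - 1)) :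
    w⁻¹ (pos a) ≠ w⁻¹ (posSucc a) := fun h => pos_ne_posSucc a (w⁻¹.injective h)

theorem invNum_mul_le (a : Fin (n - 1)) (w : Equiv.Perm (Fin n)) :
    invNum (simpleTransposition a * w) ≤ invNum w + 1 := by
  rcases (inv_pos_ne w a).lt_or_gt with h | h
  · exact (invNum_mul_of_lt h).le
  · have := invNum_mul_of_gt h
    omega

theorem gt_of_invNum_mul_le {a : Fin (n - 1)} {w : Equiv.Perm (Fin n)}
    (h : invNum (simpleTransposition a * w) ≤ invNum w) : w⁻¹ (posSucc a) < w⁻¹ (pos a) := by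
  rcases (inv_pos_ne w a).lt_or_gt with h' | h'
  · have := invNum_mul_of_lt h'
    omega
  · exact h'

theorem invNum_wordPerm_le (l : List (Fin (n - 1))) : invNum (wordPerm l) ≤ l.length := by
  induction l with
  | nil => simp
  | cons a l ih =>
    have := invNum_mul_le a (wordPerm l)
    simp only [wordPerm_cons, List.length_cons]
    omega

/-- A permutation without descents is the identity. -/
theorem exists_descent {w : Equiv.Perm (Fin n)} (hw : w ≠ 1) :
    ∃ a : Fin (n - 1), w⁻¹ (posSucc a) < w⁻¹ (pos a) := by
  by_contra! hc
  apply hw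
  obtain _ | m := n
  · exact Subsingleton.elim _ _
  have hmono : StrictMono (w⁻¹ : Equiv.Perm (Fin (m + 1))) :=
    Fin.strictMono_iff_lt_succ.2 fun i =>
      lt_of_le_of_ne (hc i) (inv_pos_ne w i)
  have h1 : (w⁻¹ : Equiv.Perm (Fin (m + 1))) = 1 := by
    have := Subsingleton.elim (hmono.orderIsoOfSurjective _ (w⁻¹).surjective)
      (OrderIso.refl (Fin (m + 1)))
    ext i
    exact congrArg Fin.val (DFunLike.congr_fun this i)
  simpa using h1

theorem exists_word (w : Equiv.Perm (Fin n)) :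
    ∃ l : List (Fin (n - 1)), wordPerm l = w ∧ l.length = invNum w := by
  induction h : invNum w generalizing w with
  | zero =>
    by_cases hw : w = 1
    · exact ⟨[], hw.symm, rfl⟩
    · obtain ⟨a, ha⟩ := exists_descent hw
      have := invNum_mul_of_gt ha
      omega
  | succ r ih =>
    have hw : w ≠ 1 := by
      rintro rfl
      simp at h
    obtain ⟨a, ha⟩ := exists_descent hw
    have := invNum_mul_of_gt ha
    obtain ⟨l, hl, hr⟩ := ih (simpleTransposition a * w) (by omega)
    exact ⟨a :: l, by simp [hl], by simp [hr]⟩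

theorem IsReducedExpression.length_eq {w : Equiv.Perm (Fin n)} {l : List (Fin (n - 1))}
    (h : IsReducedExpression w l) : l.length = invNum w := by
  obtain ⟨l', hl', hr⟩ := exists_word w
  refine le_antisymm (hr ▸ h.2 l' hl') ?_
  have := invNum_wordPerm_le l
  rwa [show wordPerm l = w from h.1] at this

theorem IsReducedExpression.wordPerm_eq {w : Equiv.Perm (Fin n)} {l : List (Fin (n - 1))}
    (h : IsReducedExpression w l) : wordPerm l = w := h.1

end Words

/-! ### Spanning by reduced words -/

section Spanning

variable {F A : Type*} [Field F] [Ring A] [Algebra F A] {n : ℕ}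

/-- The product `ψ_{a_1} ⋯ ψ_{a_r}` for a word `(a_1, …, a_r)` and a family `ψ` in a ring. -/
def wordProd (ψ : Fin (n - 1) → A) (l : List (Fin (n - 1))) : A := (l.map ψ).prod

@[simp] theorem wordProd_nil (ψ : Fin (n - 1) → A) : wordProd ψ [] = 1 := rfl

@[simp] theorem wordProd_cons (ψ : Fin (n - 1) → A) (a : Fin (n - 1)) (l : List (Fin (n - 1))) :
    wordProd ψ (a :: l) = ψ a * wordProd ψ l := by
  simp [wordProd]

/-- The relations of a quiver Hecke algebra, up to corrections in a subalgebra `P`: in the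
quiver Hecke algebra, `P` is generated by the `y_a` and the `e(k)`. -/
structure BraidModulo (P : Subalgebra F A) (ψ : Fin (n - 1) → A) : Prop where
  sq_mem : ∀ a, ψ a * ψ a ∈ P
  comm : ∀ a b : Fin (n - 1), (a : ℕ) + 1 < b ∨ (b : ℕ) + 1 < a → ψ a * ψ b = ψ b * ψ a
  braid : ∀ a b : Fin (n - 1), (b : ℕ) = a + 1 → ψ b * ψ a * ψ b - ψ a * ψ b * ψ a ∈ P
  mul_mem : ∀ p ∈ P, ∀ a, ∃ p' ∈ P, ∃ p'' ∈ P, p * ψ a = ψ a * p' + p''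

/-- The span of the elements `ψ_l p` with `p ∈ P` and `l` a word of length less than `r`. -/
def shortSpan (P : Subalgebra F A) (ψ : Fin (n - 1) → A) (r : ℕ) : Submodule F A :=
  Submodule.span F {x | ∃ l : List (Fin (n - 1)), l.length < r ∧ ∃ p ∈ P, x = wordProd ψ l * p}

variable {P : Subalgebra F A} {ψ : Fin (n - 1) → A}

theorem wordProd_mul_mem_shortSpan {r : ℕ} {l : List (Fin (n - 1))} (h : l.length < r) {p : A}
    (hp : p ∈ P) : wordProd ψ l * p ∈ shortSpan P ψ r :=
  Submodule.subset_span ⟨l, h, p, hp, rfl⟩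

theorem shortSpan_mono {r r' : ℕ} (h : r ≤ r') : shortSpan P ψ r ≤ shortSpan P ψ r' := by
  refine Submodule.span_mono ?_
  rintro x ⟨l, hl, p, hp, rfl⟩
  exact ⟨l, by omega, p, hp, rfl⟩

theorem psi_mul_mem_shortSpan {r : ℕ} {x : A} (hx : x ∈ shortSpan P ψ r) (a : Fin (n - 1)) :
    ψ a * x ∈ shortSpan P ψ (r + 1) := by
  induction hx using Submodule.span_induction with
  | mem x hx =>
    obtain ⟨l, hl, p, hp, rfl⟩ := hx
    rw [← mul_assoc, ← wordProd_cons]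
    exact wordProd_mul_mem_shortSpan (by simpa using hl) hp
  | zero => simp
  | add x y _ _ hx hy => rw [mul_add]; exact add_mem hx hy
  | smul c x _ hx => rw [mul_smul_comm]; exact Submodule.smul_mem _ _ hx

theorem mul_mem_shortSpan_right {r : ℕ} {x : A} (hx : x ∈ shortSpan P ψ r) {q : A}
    (hq : q ∈ P) : x * q ∈ shortSpan P ψ r := by
  induction hx using Submodule.span_induction with
  | mem x hx =>
    obtain ⟨l, hl, p, hp, rfl⟩ := hx
    rw [mul_assoc]
    exact wordProd_mul_mem_shortSpan hl (P.mul_mem hp hq)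
  | zero => simp
  | add x y _ _ hx hy => rw [add_mul]; exact add_mem hx hy
  | smul c x _ hx => rw [smul_mul_assoc]; exact Submodule.smul_mem _ _ hx

namespace BraidModulo

variable (h : BraidModulo P ψ)
include h

/-- Elements of `P` can be moved to the right of the `ψ_a` without increasing the length. -/
theorem mul_wordProd_mem {l : List (Fin (n - 1))} {p q : A} (hp : p ∈ P) (hq : q ∈ P) :
    p * (wordProd ψ l * q) ∈ shortSpan P ψ (l.length + 1) := by
  induction l generalizing p with
  | nil =>
    have : p * q = wordProd ψ [] * (p * q) := by simp
    rw [wordProd_nil, one_mul, this]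
    exact wordProd_mul_mem_shortSpan (by simp) (P.mul_mem hp hq)
  | cons a l ih =>
    obtain ⟨p', hp', p'', hp'', he⟩ := h.mul_mem p hp a
    rw [wordProd_cons, mul_assoc, ← mul_assoc p, he, add_mul, mul_assoc]
    exact add_mem (psi_mul_mem_shortSpan (ih hp') a) (shortSpan_mono (by simp) (ih hp''))

theorem mul_mem_shortSpan_left {r : ℕ} {x : A} (hx : x ∈ shortSpan P ψ r) {p : A}
    (hp : p ∈ P) : p * x ∈ shortSpan P ψ r := by
  induction hx using Submodule.span_induction with
  | mem x hx =>
    obtain ⟨l, hl, q, hq, rfl⟩ := hx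
    exact shortSpan_mono hl (h.mul_wordProd_mem hp hq)
  | zero => simp
  | add x y _ _ hx hy => rw [mul_add]; exact add_mem hx hy
  | smul c x _ hx => rw [mul_smul_comm]; exact Submodule.smul_mem _ _ hx

/-- Matsumoto's theorem modulo shorter words: two reduced words of the same permutation have
the same product up to shorter words. -/
theorem wordProd_sub_mem {l l' : List (Fin (n - 1))} (hl : invNum (wordPerm l) = l.length)
    (hl' : l'.length = l.length) (hw : wordPerm l = wordPerm l') :
    wordProd ψ l - wordProd ψ l' ∈ shortSpan P ψ l.length := by
  induction hr : l.length using Nat.strong_induction_on generalizing l l' with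
  | _ r ih =>
  -- The case of two words beginning with the same letter.
  have key : ∀ (c : Fin (n - 1)) (u v : List (Fin (n - 1))), invNum (wordPerm (c :: u)) = r →
      u.length + 1 = r → v.length + 1 = r → wordPerm (c :: u) = wordPerm (c :: v) →
      wordProd ψ (c :: u) - wordProd ψ (c :: v) ∈ shortSpan P ψ r := by
    intro c u v h1 h2 h3 h4
    have h5 := invNum_wordPerm_le u
    have h6 := invNum_mul_le c (wordPerm u)
    rw [wordPerm_cons] at h1
    simp only [wordPerm_cons, mul_right_inj] at h4
    have := ih u.length (by omega) (by omega) (by omega) h4 rfl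
    rw [wordProd_cons, wordProd_cons, ← mul_sub]
    exact h2 ▸ psi_mul_mem_shortSpan this c
  obtain _ | ⟨a, u⟩ := l
  · obtain rfl : l' = [] := by simpa using hl'
    simp
  obtain _ | ⟨b, v⟩ := l'
  · simp at hl'
  rw [hr] at hl hl'
  simp only [List.length_cons] at hr hl'
  -- Both first letters are descents.
  set w := wordPerm (a :: u) with hwdef
  have hda : w⁻¹ (posSucc a) < w⁻¹ (pos a) := by
    apply gt_of_invNum_mul_le
    have := invNum_wordPerm_le u
    simp only [hwdef, wordPerm_cons, simpleTransposition_mul_cancel_left] at hl ⊢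
    omega
  have hdb : w⁻¹ (posSucc b) < w⁻¹ (pos b) := by
    apply gt_of_invNum_mul_le
    have := invNum_wordPerm_le v
    rw [hw] at hl ⊢
    simp only [wordPerm_cons, simpleTransposition_mul_cancel_left] at hl ⊢
    omega
  -- It suffices to compare one word beginning with `a` with one beginning with `b`.
  have finish : ∀ u' v' : List (Fin (n - 1)), u'.length + 1 = r → v'.length + 1 = r →
      wordPerm (a :: u') = w → wordPerm (b :: v') = w →
      wordProd ψ (a :: u') - wordProd ψ (b :: v') ∈ shortSpan P ψ r →
      wordProd ψ (a :: u) - wordProd ψ (b :: v) ∈ shortSpan P ψ r := by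
    intro u' v' h1 h2 h3 h4 h5
    have e1 := key a u u' hl hr h1 h3.symm
    have e2 := key b v' v (h4 ▸ hl) h2 hl' (h4.trans hw)
    have := add_mem (add_mem e1 h5) e2
    simpa using this
  -- If `a` and `a + 1` are descents, then `w` has reduced words beginning with either side of the
  -- braid relation.
  have adjacent : ∀ a b : Fin (n - 1), (b : ℕ) = a + 1 →
      w⁻¹ (posSucc a) < w⁻¹ (pos a) → w⁻¹ (posSucc b) < w⁻¹ (pos b) →
      ∃ x : List (Fin (n - 1)), x.length + 3 = r ∧ wordPerm (a :: b :: a :: x) = w ∧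
        wordPerm (b :: a :: b :: x) = w := by
    intro a b hab ha hb
    have hp := posSucc_eq_pos hab
    have hne1 : simpleTransposition a (posSucc b) = posSucc b :=
      simpleTransposition_of_ne (by simp [posSucc, pos, Fin.ext_iff]; omega)
        (by simp [posSucc, Fin.ext_iff]; omega)
    have hne2 : simpleTransposition b (pos a) = pos a :=
      simpleTransposition_of_ne (by simp [pos, Fin.ext_iff]; omega)
        (by simp [pos, posSucc, Fin.ext_iff]; omega)
    have n1 := invNum_mul_of_gt ha
    have n2 := invNum_mul_of_gt (a := b) (w := simpleTransposition a * w) (by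
      simp only [mul_inv_rev, simpleTransposition_inv, Equiv.Perm.mul_apply, hne1, ← hp,
        simpleTransposition_posSucc]
      rw [← hp] at hb
      exact hb.trans ha)
    have n3 := invNum_mul_of_gt (a := a)
      (w := simpleTransposition b * (simpleTransposition a * w)) (by
      simp only [mul_inv_rev, simpleTransposition_inv, Equiv.Perm.mul_apply, hne2,
        simpleTransposition_pos]
      rw [hp, simpleTransposition_pos, hne1, ← hp]
      exact hp ▸ hb)
    obtain ⟨x, hx, hxl⟩ := exists_word
      (simpleTransposition a * (simpleTransposition b * (simpleTransposition a * w)))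
    have hfirst : wordPerm (a :: b :: a :: x) = w := by simp [hx]
    refine ⟨x, by omega, hfirst, ?_⟩
    rw [← hfirst]
    simp only [wordPerm_cons, ← mul_assoc, simpleTransposition_braid hab]
  have adjacent_mem : ∀ (a b : Fin (n - 1)) (x : List (Fin (n - 1))), (b : ℕ) = a + 1 →
      x.length + 3 = r →
      wordProd ψ (b :: a :: b :: x) - wordProd ψ (a :: b :: a :: x) ∈ shortSpan P ψ r := by
    intro a b x hab hx
    have : wordProd ψ (b :: a :: b :: x) - wordProd ψ (a :: b :: a :: x)
        = (ψ b * ψ a * ψ b - ψ a * ψ b * ψ a) * (wordProd ψ x * 1) := by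
      simp only [wordProd_cons]
      noncomm_ring
    rw [this]
    exact shortSpan_mono (by omega) (h.mul_wordProd_mem (h.braid a b hab) P.one_mem)
  -- If `a` and `b` are distant, then `w` has reduced words beginning with `a b` and with `b a`.
  have distant : (a : ℕ) + 1 < b ∨ (b : ℕ) + 1 < a →
      wordProd ψ (a :: u) - wordProd ψ (b :: v) ∈ shortSpan P ψ r := by
    intro hab
    have n1 := invNum_mul_of_gt hda
    have n2 := invNum_mul_of_gt (a := b) (w := simpleTransposition a * w) (by
      simp only [mul_inv_rev, simpleTransposition_inv, Equiv.Perm.mul_apply]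
      rwa [simpleTransposition_of_ne (by simp [posSucc, pos, Fin.ext_iff]; omega)
          (by simp [posSucc, Fin.ext_iff]; omega),
        simpleTransposition_of_ne (by simp [pos, Fin.ext_iff]; omega)
          (by simp [posSucc, pos, Fin.ext_iff]; omega)])
    obtain ⟨x, hx, hxl⟩ := exists_word (simpleTransposition b * (simpleTransposition a * w))
    have hfirst : wordPerm (a :: b :: x) = w := by simp [hx]
    refine finish (b :: x) (a :: x) (by simp; omega) (by simp; omega) hfirst ?_ ?_
    · rw [← hfirst]
      simp only [wordPerm_cons, ← mul_assoc, simpleTransposition_comm hab]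
    · simp only [wordProd_cons, ← mul_assoc, h.comm a b hab, sub_self, zero_mem]
  rcases lt_trichotomy (a : ℕ) b with hab | hab | hab
  · rcases (Nat.succ_le_of_lt hab).eq_or_lt with hab' | hab'
    · obtain ⟨x, hx, h1, h2⟩ := adjacent a b hab'.symm hda hdb
      refine finish (b :: a :: x) (a :: b :: x) (by simpa using hx) (by simpa using hx) h1 h2 ?_
      rw [← neg_sub]
      exact neg_mem (adjacent_mem a b x hab'.symm hx)
    · exact distant (Or.inl hab')
  · obtain rfl : a = b := Fin.ext hab
    exact key a u v hl hr hl' hw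
  · rcases (Nat.succ_le_of_lt hab).eq_or_lt with hab' | hab'
    · obtain ⟨x, hx, h1, h2⟩ := adjacent b a hab'.symm hdb hda
      exact finish (b :: a :: x) (a :: b :: x) (by simpa using hx) (by simpa using hx) h2 h1
        (adjacent_mem b a x hab'.symm hx)
    · exact distant (Or.inr hab')

/-- If `u` is reduced and `a u` is not, then `u` may be replaced by a reduced word beginning with
`a`, so that a factor `ψ_a ^ 2 ∈ P` appears. -/
theorem wordProd_mem_of_not_reduced {l : List (Fin (n - 1))}
    (hl : invNum (wordPerm l) < l.length) : wordProd ψ l ∈ shortSpan P ψ l.length := by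
  induction l with
  | nil => simp at hl
  | cons a u ih =>
    rw [wordProd_cons]
    rcases (invNum_wordPerm_le u).lt_or_eq with hu | hu
    · exact psi_mul_mem_shortSpan (ih hu) a
    · simp only [wordPerm_cons, List.length_cons] at hl
      have hd := invNum_mul_of_gt (gt_of_invNum_mul_le (a := a) (w := wordPerm u) (by omega))
      obtain ⟨x, hx, hxl⟩ := exists_word (simpleTransposition a * wordPerm u)
      have h1 := h.wordProd_sub_mem (l' := a :: x) hu (by simp; omega) (by simp [hx])
      have h2 := h.mul_wordProd_mem (l := x) (h.sq_mem a) P.one_mem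
      have h3 := add_mem (psi_mul_mem_shortSpan h1 a) (shortSpan_mono (by simp; omega) h2)
      simpa [mul_sub, mul_assoc] using h3

/-- One reduced word for each permutation suffices to span, whatever the choice. -/
theorem shortSpan_le {red : Equiv.Perm (Fin n) → List (Fin (n - 1))}
    (hred : ∀ w, wordPerm (red w) = w) (hlen : ∀ w, (red w).length = invNum w) (r : ℕ) :
    shortSpan P ψ r ≤ Submodule.span F {x | ∃ w, ∃ p ∈ P, x = wordProd ψ (red w) * p} := by
  induction r with
  | zero =>
    refine Submodule.span_le.2 ?_
    rintro x ⟨l, hl, -⟩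
    omega
  | succ r ih =>
    refine Submodule.span_le.2 ?_
    rintro x ⟨l, hl, p, hp, rfl⟩
    have hshort := (shortSpan_mono (P := P) (ψ := ψ) (Nat.lt_succ_iff.1 hl)).trans ih
    rcases (invNum_wordPerm_le l).lt_or_eq with hu | hu
    · exact hshort (mul_mem_shortSpan_right (h.wordProd_mem_of_not_reduced hu) hp)
    · have h1 := h.wordProd_sub_mem (l' := red (wordPerm l)) hu (by rw [hlen, hu]) (hred _).symm
      have h2 := add_mem (hshort (mul_mem_shortSpan_right h1 hp))
        (Submodule.subset_span ⟨wordPerm l, p, hp, rfl⟩)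
      simpa [sub_mul] using h2

end BraidModulo

end Spanning

/-! ### Spanning sets of quiver Hecke algebras -/

section Relations

variable {K : Type*} (F : Type*) [Field F] (Γ : Digraph K) {n : ℕ} {β : K →₀ ℕ}

/-- The element `e(k)` of the quiver Hecke algebra. -/
def genE (k : tuples n β) : QHAlgebra F Γ n β := gen F Γ (Gen.e k)

/-- The element `y_a` of the quiver Hecke algebra. -/
def genY (a : Fin n) : QHAlgebra F Γ n β := gen F Γ (Gen.y a)

/-- The element `ψ_a` of the quiver Hecke algebra. -/
def genPsi (a : Fin (n - 1)) : QHAlgebra F Γ n β := gen F Γ (Gen.psi a)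

theorem mk_freeE (k : tuples n β) :
    RingQuot.mkAlgHom F (Rel F Γ) (freeE F k) = genE F Γ k := rfl

theorem mk_freeY (a : Fin n) :
    RingQuot.mkAlgHom F (Rel F Γ (β := β)) (freeY F a) = genY F Γ a := rfl

theorem mk_freePsi (a : Fin (n - 1)) :
    RingQuot.mkAlgHom F (Rel F Γ (β := β)) (freePsi F a) = genPsi F Γ a := rfl

theorem sum_genE : ∑ k : tuples n β, genE F Γ k = 1 := by
  simpa only [map_sum, map_one, mk_freeE, mk_freeY, mk_freePsi] using
    RingQuot.mkAlgHom_rel F (Rel.sum_e (F := F) (Γ := Γ))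

theorem genE_mul_self (k : tuples n β) : genE F Γ k * genE F Γ k = genE F Γ k := by
  simpa only [map_mul, mk_freeE, mk_freeY, mk_freePsi] using
    RingQuot.mkAlgHom_rel F (Rel.e_mul_self (F := F) (Γ := Γ) k)

theorem genE_mul_ne {k k' : tuples n β} (h : k ≠ k') : genE F Γ k * genE F Γ k' = 0 := by
  simpa only [map_mul, map_zero, mk_freeE, mk_freeY, mk_freePsi] using
    RingQuot.mkAlgHom_rel F (Rel.e_mul_ne (F := F) (Γ := Γ) k k' h)

theorem genY_mul_genE (a : Fin n) (k : tuples n β) :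
    genY F Γ a * genE F Γ k = genE F Γ k * genY F Γ a := by
  simpa only [map_mul, mk_freeE, mk_freeY, mk_freePsi] using
    RingQuot.mkAlgHom_rel F (Rel.y_e (F := F) (Γ := Γ) a k)

theorem genPsi_mul_genE (a : Fin (n - 1)) (k : tuples n β) :
    genPsi F Γ a * genE F Γ k = genE F Γ (swapTuple a k) * genPsi F Γ a := by
  simpa only [map_mul, mk_freeE, mk_freeY, mk_freePsi] using
    RingQuot.mkAlgHom_rel F (Rel.psi_e (F := F) (Γ := Γ) a k)

theorem genY_mul_genY (a b : Fin n) :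
    (genY F Γ a * genY F Γ b : QHAlgebra F Γ n β) = genY F Γ b * genY F Γ a := by
  simpa only [map_mul, mk_freeE, mk_freeY, mk_freePsi] using
    RingQuot.mkAlgHom_rel F (Rel.y_y (F := F) (Γ := Γ) a b)

theorem genPsi_mul_genY {a : Fin (n - 1)} {b : Fin n} (h : b ≠ pos a) (h' : b ≠ posSucc a) :
    (genPsi F Γ a * genY F Γ b : QHAlgebra F Γ n β) = genY F Γ b * genPsi F Γ a := by
  simpa only [map_mul, mk_freeE, mk_freeY, mk_freePsi] using
    RingQuot.mkAlgHom_rel F (Rel.psi_y (F := F) (Γ := Γ) a b h h')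

theorem genPsi_mul_genPsi {a b : Fin (n - 1)} (h : (a : ℕ) + 1 < b ∨ (b : ℕ) + 1 < a) :
    (genPsi F Γ a * genPsi F Γ b : QHAlgebra F Γ n β) = genPsi F Γ b * genPsi F Γ a := by
  simpa only [map_mul, mk_freeE, mk_freeY, mk_freePsi] using
    RingQuot.mkAlgHom_rel F (Rel.psi_psi (F := F) (Γ := Γ) a b h)

/-- The sum of the `e(k)` with `k_a = k_{a+1}`, which is the correction in the commutation
relations of `ψ_a` with `y_a` and `y_{a+1}`. -/
def eqIdempotent (a : Fin (n - 1)) : QHAlgebra F Γ n β :=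
  open Classical in
  ∑ k : tuples n β, if k.1 (pos a) = k.1 (posSucc a) then genE F Γ k else 0

/-- An identity holds if it holds after multiplication by each `e(k)`. -/
theorem eq_of_mul_genE {x y : QHAlgebra F Γ n β}
    (h : ∀ k : tuples n β, x * genE F Γ k = y * genE F Γ k) : x = y := by
  rw [← mul_one x, ← mul_one y, ← sum_genE, Finset.mul_sum, Finset.mul_sum]
  exact Finset.sum_congr rfl fun k _ => h k

open Classical in
theorem eqIdempotent_mul_genE (a : Fin (n - 1)) (k : tuples n β) :
    eqIdempotent F Γ a * genE F Γ k
      = if k.1 (pos a) = k.1 (posSucc a) then genE F Γ k else 0 := by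
  rw [eqIdempotent, Finset.sum_mul, Finset.sum_eq_single k]
  · split_ifs
    · exact genE_mul_self F Γ k
    · exact zero_mul _
  · intro k' _ hk
    split_ifs
    · exact genE_mul_ne F Γ hk
    · exact zero_mul _
  · simp

theorem genPsi_mul_genY_posSucc (a : Fin (n - 1)) :
    (genPsi F Γ a * genY F Γ (posSucc a) : QHAlgebra F Γ n β)
      = genY F Γ (pos a) * genPsi F Γ a + eqIdempotent F Γ a := by
  refine eq_of_mul_genE F Γ fun k => ?_
  rw [add_mul, eqIdempotent_mul_genE]
  split_ifs with h
  · simpa only [map_mul, map_add, map_one, add_mul, one_mul, mk_freeE, mk_freeY, mk_freePsi] using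
      RingQuot.mkAlgHom_rel F (Rel.psi_y_succ_eq (F := F) (Γ := Γ) a k h)
  · simpa only [map_mul, add_zero, mk_freeE, mk_freeY, mk_freePsi] using
      RingQuot.mkAlgHom_rel F (Rel.psi_y_succ_ne (F := F) (Γ := Γ) a k h)

theorem genY_posSucc_mul_genPsi (a : Fin (n - 1)) :
    (genY F Γ (posSucc a) * genPsi F Γ a : QHAlgebra F Γ n β)
      = genPsi F Γ a * genY F Γ (pos a) + eqIdempotent F Γ a := by
  refine eq_of_mul_genE F Γ fun k => ?_
  rw [add_mul, eqIdempotent_mul_genE]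
  split_ifs with h
  · simpa only [map_mul, map_add, map_one, add_mul, one_mul, mk_freeE, mk_freeY, mk_freePsi] using
      RingQuot.mkAlgHom_rel F (Rel.y_succ_psi_eq (F := F) (Γ := Γ) a k h)
  · simpa only [map_mul, add_zero, mk_freeE, mk_freeY, mk_freePsi] using
      RingQuot.mkAlgHom_rel F (Rel.y_succ_psi_ne (F := F) (Γ := Γ) a k h)

variable (n β) in
/-- The subalgebra generated by the `y_a` and the `e(k)`. -/
def diagSubalgebra : Subalgebra F (QHAlgebra F Γ n β) :=
  Algebra.adjoin F (Set.range (genY F Γ) ∪ Set.range (genE F Γ))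

theorem genY_mem (a : Fin n) : genY F Γ a ∈ diagSubalgebra F Γ n β :=
  Algebra.subset_adjoin (Or.inl ⟨a, rfl⟩)

theorem genE_mem (k : tuples n β) : genE F Γ k ∈ diagSubalgebra F Γ n β :=
  Algebra.subset_adjoin (Or.inr ⟨k, rfl⟩)

theorem eqIdempotent_mem (a : Fin (n - 1)) : eqIdempotent F Γ a ∈ diagSubalgebra F Γ n β := by
  refine sum_mem fun k _ => ?_
  split_ifs
  · exact genE_mem F Γ k
  · exact zero_mem _

theorem mem_diagSubalgebra_of_mul_genE {x : QHAlgebra F Γ n β}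
    (h : ∀ k, x * genE F Γ k ∈ diagSubalgebra F Γ n β) : x ∈ diagSubalgebra F Γ n β := by
  rw [← mul_one x, ← sum_genE, Finset.mul_sum]
  exact sum_mem fun k _ => h k

theorem swapTuple_swapTuple (a : Fin (n - 1)) (k : tuples n β) :
    swapTuple a (swapTuple a k) = k :=
  Subtype.ext (funext fun b => by simp [swapTuple])

theorem diagSubalgebra_mul_genPsi {p : QHAlgebra F Γ n β} (hp : p ∈ diagSubalgebra F Γ n β)
    (a : Fin (n - 1)) : ∃ p' ∈ diagSubalgebra F Γ n β, ∃ p'' ∈ diagSubalgebra F Γ n β,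
      p * genPsi F Γ a = genPsi F Γ a * p' + p'' := by
  induction hp using Algebra.adjoin_induction with
  | mem x hx =>
    rcases hx with ⟨b, rfl⟩ | ⟨k, rfl⟩
    · by_cases h1 : b = pos a
      · subst h1
        refine ⟨_, genY_mem F Γ (posSucc a), _, neg_mem (eqIdempotent_mem F Γ a), ?_⟩
        rw [genPsi_mul_genY_posSucc, add_neg_cancel_right]
      · by_cases h2 : b = posSucc a
        · subst h2
          exact ⟨_, genY_mem F Γ (pos a), _, eqIdempotent_mem F Γ a,
            genY_posSucc_mul_genPsi F Γ a⟩
        · exact ⟨_, genY_mem F Γ b, 0, zero_mem _, by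
            rw [genPsi_mul_genY F Γ h1 h2, add_zero]⟩
    · exact ⟨_, genE_mem F Γ (swapTuple a k), 0, zero_mem _, by
        rw [genPsi_mul_genE, swapTuple_swapTuple, add_zero]⟩
  | algebraMap r =>
    exact ⟨_, Subalgebra.algebraMap_mem _ r, 0, zero_mem _, by
      rw [Algebra.commutes, add_zero]⟩
  | add x y _ _ hx hy =>
    obtain ⟨x', hx', x'', hx'', ex⟩ := hx
    obtain ⟨y', hy', y'', hy'', ey⟩ := hy
    exact ⟨_, add_mem hx' hy', _, add_mem hx'' hy'', by
      rw [add_mul, ex, ey, mul_add]; abel⟩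
  | mul x y hx0 _ hx hy =>
    obtain ⟨x', hx', x'', hx'', ex⟩ := hx
    obtain ⟨y', hy', y'', hy'', ey⟩ := hy
    refine ⟨x' * y', mul_mem hx' hy', x'' * y' + x * y'',
      add_mem (mul_mem hx'' hy') (mul_mem hx0 hy''), ?_⟩
    rw [mul_assoc, ey, mul_add, ← mul_assoc, ex]
    noncomm_ring

theorem braidModulo :
    BraidModulo (diagSubalgebra F Γ n β) (genPsi F Γ) where
  sq_mem a := by
    refine mem_diagSubalgebra_of_mul_genE F Γ fun k => ?_
    have hy := genY_mem F Γ (n := n) (β := β)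
    have hk := genE_mem F Γ k
    rw [← pow_two]
    by_cases h : k.1 (pos a) = k.1 (posSucc a)
    · have := RingQuot.mkAlgHom_rel F (Rel.psi_sq_eq (F := F) (Γ := Γ) a k h)
      simp only [map_mul, map_pow, map_zero, mk_freeE, mk_freePsi] at this
      exact this ▸ zero_mem _
    by_cases h1 : Γ.Adj (k.1 (pos a)) (k.1 (posSucc a)) <;>
    by_cases h2 : Γ.Adj (k.1 (posSucc a)) (k.1 (pos a))
    · have := RingQuot.mkAlgHom_rel F (Rel.psi_sq_double (F := F) (Γ := Γ) a k ⟨h1, h2⟩)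
      simp only [map_mul, map_pow, map_sub, mk_freeE, mk_freeY, mk_freePsi] at this
      exact this ▸ mul_mem (mul_mem (sub_mem (hy _) (hy _)) (sub_mem (hy _) (hy _))) hk
    · have := RingQuot.mkAlgHom_rel F (Rel.psi_sq_right (F := F) (Γ := Γ) a k ⟨h1, h2⟩)
      simp only [map_mul, map_pow, map_sub, mk_freeE, mk_freeY, mk_freePsi] at this
      exact this ▸ mul_mem (sub_mem (hy _) (hy _)) hk
    · have := RingQuot.mkAlgHom_rel F (Rel.psi_sq_left (F := F) (Γ := Γ) a k ⟨h2, h1⟩)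
      simp only [map_mul, map_pow, map_sub, mk_freeE, mk_freeY, mk_freePsi] at this
      exact this ▸ mul_mem (sub_mem (hy _) (hy _)) hk
    · have := RingQuot.mkAlgHom_rel F (Rel.psi_sq_noEdge (F := F) (Γ := Γ) a k h ⟨h1, h2⟩)
      simp only [map_mul, map_pow, mk_freeE, mk_freePsi] at this
      rwa [this]
  comm a b h := genPsi_mul_genPsi F Γ h
  braid a b hab := by
    refine mem_diagSubalgebra_of_mul_genE F Γ fun k => ?_
    have hy := genY_mem F Γ (n := n) (β := β)
    have hk := genE_mem F Γ k
    rw [sub_mul]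
    by_cases h0 : k.1 (posSucc b) = k.1 (pos a) ∧
        (Arrow Γ (k.1 (pos a)) (k.1 (posSucc a)) ∨ Arrow Γ (k.1 (posSucc a)) (k.1 (pos a)) ∨
          DoubleArrow Γ (k.1 (pos a)) (k.1 (posSucc a)))
    · obtain ⟨h, h1 | h1 | h1⟩ := h0
      · have := RingQuot.mkAlgHom_rel F (Rel.braid_right (F := F) (Γ := Γ) a b hab k h h1)
        simp only [map_mul, map_sub, map_one, mk_freeE, mk_freePsi] at this
        rw [this, ← sub_mul,
          sub_sub_cancel_left]
        exact mul_mem (neg_mem (one_mem _)) hk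
      · have := RingQuot.mkAlgHom_rel F (Rel.braid_left (F := F) (Γ := Γ) a b hab k h h1)
        simp only [map_mul, map_add, map_one, mk_freeE, mk_freePsi] at this
        rw [this, ← sub_mul,
          add_sub_cancel_left]
        exact mul_mem (one_mem _) hk
      · have := RingQuot.mkAlgHom_rel F (Rel.braid_double (F := F) (Γ := Γ) a b hab k h h1)
        simp only [map_mul, map_add, map_sub, map_ofNat, mk_freeE, mk_freeY, mk_freePsi] at this
        rw [this, ← sub_mul]
        have e : ∀ x u v w : QHAlgebra F Γ n β,
            x + 2 * u - v - w - x = 2 * u - v - w := fun x u v w => by abel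
        rw [e]
        exact mul_mem (sub_mem (sub_mem (mul_mem (ofNat_mem _ 2) (hy _)) (hy _)) (hy _)) hk
    · have := RingQuot.mkAlgHom_rel F (Rel.braid_other (F := F) (Γ := Γ) a b hab k h0)
      simp only [map_mul, mk_freeE, mk_freePsi] at this
      rw [this, sub_self]
      exact zero_mem _
  mul_mem p hp a := diagSubalgebra_mul_genPsi F Γ hp a

variable {F Γ}

/-- Induction on the generators: a subspace containing `x` and stable under left multiplication
by the generators contains all left multiples of `x`. -/
theorem mul_mem_of_gen_mul_mem {M : Submodule F (QHAlgebra F Γ n β)}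
    (he : ∀ k, ∀ x ∈ M, genE F Γ k * x ∈ M) (hy : ∀ a, ∀ x ∈ M, genY F Γ a * x ∈ M)
    (hpsi : ∀ a, ∀ x ∈ M, genPsi F Γ a * x ∈ M) (z : QHAlgebra F Γ n β)
    {x : QHAlgebra F Γ n β} (hx : x ∈ M) : z * x ∈ M := by
  obtain ⟨z, rfl⟩ := RingQuot.mkAlgHom_surjective F (Rel F Γ (n := n) (β := β)) z
  induction z using FreeAlgebra.induction generalizing x with
  | grade0 r =>
    rw [AlgHom.commutes, ← Algebra.smul_def]
    exact M.smul_mem r hx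
  | grade1 g =>
    cases g with
    | e k => exact he k x hx
    | y a => exact hy a x hx
    | psi a => exact hpsi a x hx
  | mul u v hu hv => rw [map_mul, mul_assoc]; exact hu (hv hx)
  | add u v hu hv => rw [map_add, add_mul]; exact add_mem (hu hx) (hv hx)

theorem mem_span_wordProd
    {red : Equiv.Perm (Fin n) → List (Fin (n - 1))}
    (hred : ∀ w, IsReducedExpression w (red w)) (z : QHAlgebra F Γ n β) :
    z ∈ Submodule.span F
      {x | ∃ w, ∃ p ∈ diagSubalgebra F Γ n β, x = wordProd (genPsi F Γ) (red w) * p} := by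
  have h := braidModulo F Γ (n := n) (β := β)
  set S := fun r => shortSpan (diagSubalgebra F Γ n β) (genPsi F Γ) r with hS
  have hdir : Monotone S := fun r r' hr => shortSpan_mono hr
  have hmem : ∀ x, x ∈ ⨆ r, S r ↔ ∃ r, x ∈ S r :=
    fun x => Submodule.mem_iSup_of_directed S hdir.directed_le
  have h1 : (1 : QHAlgebra F Γ n β) ∈ ⨆ r, S r := (hmem _).2 ⟨1, by
    simpa using wordProd_mul_mem_shortSpan (ψ := genPsi F Γ) (l := []) (r := 1) (by simp)
      (one_mem (diagSubalgebra F Γ n β))⟩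
  have h2 : z * 1 ∈ ⨆ r, S r := by
    refine mul_mem_of_gen_mul_mem ?_ ?_ ?_ z h1
    · intro k x hx
      obtain ⟨r, hr⟩ := (hmem x).1 hx
      exact (hmem _).2 ⟨r, h.mul_mem_shortSpan_left hr (genE_mem F Γ k)⟩
    · intro a x hx
      obtain ⟨r, hr⟩ := (hmem x).1 hx
      exact (hmem _).2 ⟨r, h.mul_mem_shortSpan_left hr (genY_mem F Γ a)⟩
    · intro a x hx
      obtain ⟨r, hr⟩ := (hmem x).1 hx
      exact (hmem _).2 ⟨r + 1, psi_mul_mem_shortSpan hr a⟩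
  rw [mul_one] at h2
  exact iSup_le (h.shortSpan_le (fun w => (hred w).wordPerm_eq) fun w => (hred w).length_eq) h2

/-- The product `y_1^{m_1} ⋯ y_n^{m_n}` for a family `y` in a ring. -/
def monomialProd {A : Type*} [Monoid A] {n : ℕ} (y : Fin n → A) (m : Fin n → ℕ) : A :=
  (List.ofFn fun a => y a ^ m a).prod

theorem mul_monomialProd {A : Type*} [Monoid A] {n : ℕ} {y : Fin n → A}
    (hy : ∀ a b, y a * y b = y b * y a) (b : Fin n) (m : Fin n → ℕ) :
    y b * monomialProd y m = monomialProd y (m + Pi.single b 1) := by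
  induction n with
  | zero => exact b.elim0
  | succ n ih =>
    simp only [monomialProd, List.ofFn_succ, List.prod_cons] at ih ⊢
    refine Fin.cases ?_ (fun b => ?_) b
    · rw [← mul_assoc, ← pow_succ']
      simp [Fin.succ_ne_zero]
    · have hc : Commute (y b.succ) (y 0) := hy b.succ 0
      rw [← mul_assoc, (hc.pow_right _).eq, mul_assoc,
        ih (fun a b => hy a.succ b.succ) b]
      simp [Pi.single_apply, Fin.ext_iff]

theorem genE_mul_monomialProd (k : tuples n β) (m : Fin n → ℕ) :
    genE F Γ k * monomialProd (genY F Γ) m = monomialProd (genY F Γ) m * genE F Γ k := by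
  have : Commute (genE F Γ k) (monomialProd (genY F Γ) m) := by
    refine Commute.list_prod_right _ _ fun x hx => ?_
    obtain ⟨a, rfl⟩ := (List.mem_ofFn' _ _).1 hx
    exact Commute.pow_right (genY_mul_genE F Γ a k).symm _
  exact this.eq

theorem diagSubalgebra_mul_genE_mem {p : QHAlgebra F Γ n β} (hp : p ∈ diagSubalgebra F Γ n β)
    (k : tuples n β) : p * genE F Γ k ∈
      Submodule.span F (Set.range fun m => monomialProd (genY F Γ) m * genE F Γ k) := by
  set M := Submodule.span F (Set.range fun m => monomialProd (genY F Γ) m * genE F Γ k) with hM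
  have hbase : genE F Γ k ∈ M := Submodule.subset_span ⟨0, by simp [monomialProd]⟩
  suffices H : ∀ x ∈ M, p * x ∈ M from H _ hbase
  induction hp using Algebra.adjoin_induction with
  | mem g hg =>
    intro x hx
    induction hx using Submodule.span_induction with
    | mem x hx =>
      obtain ⟨m, rfl⟩ := hx
      rcases hg with ⟨b, rfl⟩ | ⟨k', rfl⟩
      · refine Submodule.subset_span ⟨m + Pi.single b 1, ?_⟩
        simp only [← mul_assoc, mul_monomialProd (genY_mul_genY F Γ)]
      · rw [← mul_assoc, genE_mul_monomialProd, mul_assoc]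
        by_cases hk : k' = k
        · subst hk
          exact Submodule.subset_span ⟨m, by rw [genE_mul_self]⟩
        · rw [genE_mul_ne F Γ hk, mul_zero]
          exact zero_mem _
    | zero => simp
    | add x y _ _ hx hy => rw [mul_add]; exact add_mem hx hy
    | smul c x _ hx => rw [mul_smul_comm]; exact Submodule.smul_mem _ _ hx
  | algebraMap r =>
    intro x hx
    rw [← Algebra.smul_def]
    exact M.smul_mem r hx
  | add u v _ _ hu hv => exact fun x hx => by rw [add_mul]; exact add_mem (hu x hx) (hv x hx)
  | mul u v _ _ hu hv => exact fun x hx => by rw [mul_assoc]; exact hu _ (hv x hx)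

/-- The spanning half of the basis theorem for the quiver Hecke algebra. -/
theorem mul_genE_mem_span
    {red : Equiv.Perm (Fin n) → List (Fin (n - 1))}
    (hred : ∀ w, IsReducedExpression w (red w)) (z : QHAlgebra F Γ n β) (k : tuples n β) :
    z * genE F Γ k ∈ Submodule.span F (Set.range fun i : Equiv.Perm (Fin n) × (Fin n → ℕ) =>
      wordProd (genPsi F Γ) (red i.1) * monomialProd (genY F Γ) i.2 * genE F Γ k) := by
  have hz := mem_span_wordProd hred z
  induction hz using Submodule.span_induction with
  | mem x hx =>
    obtain ⟨w, p, hp, rfl⟩ := hx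
    rw [mul_assoc]
    have hpk := diagSubalgebra_mul_genE_mem hp k
    generalize p * genE F Γ k = q at hpk
    induction hpk using Submodule.span_induction with
    | mem x hx =>
      obtain ⟨m, rfl⟩ := hx
      exact Submodule.subset_span ⟨(w, m), by simp only [mul_assoc]⟩
    | zero => simp
    | add x y _ _ hx hy => rw [mul_add]; exact add_mem hx hy
    | smul c x _ hx => rw [mul_smul_comm]; exact Submodule.smul_mem _ _ hx
  | zero => simp
  | add x y _ _ hx hy => rw [add_mul]; exact add_mem hx hy
  | smul c x _ hx => rw [smul_mul_assoc]; exact Submodule.smul_mem _ _ hx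

end Relations

/-! ### The representation on the orbit of a generic point -/

section Scalars

variable {K : Type*} (Γ : Digraph K) {L : Type*} [Field L]

open Classical in
/-- The coefficient of `s_a` in the action of `ψ_a` at a point where the labels in positions
`a`, `a + 1` are `i`, `j` and the variables are `u`, `v`. -/
def swapCoeff (i j : K) (u v : L) : L :=
  if i = j then (u - v)⁻¹ else if Γ.Adj j i then u - v else 1

open Classical in
/-- The coefficient of the identity in the action of `ψ_a`. -/
def stayCoeff (i j : K) (u v : L) : L := if i = j then (v - u)⁻¹ else 0

open Classical in
/-- The scalar by which `ψ_a ^ 2` acts at a point with labels `i`, `j` and variables `u`, `v`. -/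
def sqCoeff (i j : K) (u v : L) : L :=
  if i = j then 0
  else if Γ.Adj i j then (if Γ.Adj j i then (v - u) * (u - v) else v - u)
  else if Γ.Adj j i then u - v else 1

open Classical in
/-- The scalar by which the difference of the two sides of the braid relation acts at a point
with labels `i`, `j`, `l` and variables `u`, `v`, `t`. -/
def braidCoeff (i j l : K) (u v t : L) : L :=
  if l = i then
    if Γ.Adj i j then (if Γ.Adj j i then 2 * v - u - t else -1)
    else if Γ.Adj j i then 1 else 0
  else 0

variable {Γ}

theorem swapCoeff_ne_zero (i j : K) {u v : L} (h : u ≠ v) : swapCoeff Γ i j u v ≠ 0 := by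
  have := sub_ne_zero.2 h
  unfold swapCoeff
  split_ifs <;> simp [this]

/-- The relation for `ψ_a ^ 2` at one point of the orbit: `f` and `g` are the values of a function
at the point and at its image under `s_a`. -/
theorem sqCoeff_identity (i j : K) {u v : L} (h : u ≠ v) (f g : L) :
    swapCoeff Γ i j u v * (swapCoeff Γ j i v u * f + stayCoeff j i v u * g)
      + stayCoeff i j u v * (swapCoeff Γ i j u v * g + stayCoeff i j u v * f)
      = sqCoeff Γ i j u v * f := by
  have h1 := sub_ne_zero.2 h
  have h2 := sub_ne_zero.2 h.symm
  unfold swapCoeff stayCoeff sqCoeff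
  by_cases hij : i = j
  · subst hij
    simp only [if_true]
    field_simp
    ring
  · by_cases h3 : Γ.Adj i j <;> by_cases h4 : Γ.Adj j i <;>
      simp [hij, Ne.symm hij, h3, h4]
    ring

/-- The braid relation at one point of the orbit: `f`, `fa`, `fb`, `fab`, `fba` and `fc` are the
values of a function at the translates of the point by `1`, `s_a`, `s_b`, `s_a s_b`, `s_b s_a` and
`s_a s_b s_a`, where `b = a + 1`. -/
theorem braidCoeff_identity (hΓ : ∀ k, ¬ Γ.Adj k k) (i j l : K) {u v t : L} (huv : u ≠ v)
    (hvt : v ≠ t) (hut : u ≠ t) (f fa fb fab fba fc : L) :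
    swapCoeff Γ j l v t *
        (swapCoeff Γ i l u t * (swapCoeff Γ i j u v * fc + stayCoeff i j u v * fba)
          + stayCoeff i l u t * (swapCoeff Γ l j t v * f + stayCoeff l j t v * fb))
      + stayCoeff j l v t *
        (swapCoeff Γ i j u v * (swapCoeff Γ i l u t * fab + stayCoeff i l u t * fa)
          + stayCoeff i j u v * (swapCoeff Γ j l v t * fb + stayCoeff j l v t * f))
      = swapCoeff Γ i j u v *
        (swapCoeff Γ i l u t * (swapCoeff Γ j l v t * fc + stayCoeff j l v t * fab)
          + stayCoeff i l u t * (swapCoeff Γ j i v u * f + stayCoeff j i v u * fa))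
      + stayCoeff i j u v *
        (swapCoeff Γ j l v t * (swapCoeff Γ i l u t * fba + stayCoeff i l u t * fb)
          + stayCoeff j l v t * (swapCoeff Γ i j u v * fa + stayCoeff i j u v * f))
      + braidCoeff Γ i j l u v t * f := by
  have h1 := sub_ne_zero.2 huv
  have h2 := sub_ne_zero.2 huv.symm
  have h3 := sub_ne_zero.2 hvt
  have h4 := sub_ne_zero.2 hvt.symm
  have h5 := sub_ne_zero.2 hut
  have h6 := sub_ne_zero.2 hut.symm
  unfold swapCoeff stayCoeff braidCoeff
  by_cases hij : i = j
  · subst hij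
    by_cases hil : i = l
    · subst hil
      simp only [if_true, hΓ, if_false]
      field_simp
      ring
    · simp only [if_true, hil, Ne.symm hil, if_false, zero_mul, add_zero]
      split_ifs <;> field_simp
  · by_cases hil : i = l
    · subst hil
      by_cases a1 : Γ.Adj i j <;> by_cases a2 : Γ.Adj j i <;>
        simp only [if_true, hij, Ne.symm hij, if_false, zero_mul, add_zero,
          a1, a2] <;> field_simp <;> ring
    · by_cases hjl : j = l
      · subst hjl
        simp only [if_true, hij, Ne.symm hij, if_false, zero_mul, add_zero]
        split_ifs <;> field_simp
      · simp only [hij, hil, hjl, Ne.symm hil, if_false, zero_mul, add_zero]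
        ring

end Scalars

section Representation

variable {K : Type*} {F : Type*} [Field F] (Γ : Digraph K)
variable {L : Type*} [Field L] [Algebra F L] {n : ℕ} {β : K →₀ ℕ}
variable (k₀ : Fin n → K) (x : Fin n → L)

/-- The action of `ψ_a` on functions on the orbit of `(k₀, x)` under the symmetric group. The
orbit is parametrized by the permutations `w`: the point attached to `w` has the label
`k₀ (w b)` and the variable `x (w b)` in position `b`. -/
def repPsi (a : Fin (n - 1)) : Module.End L (Equiv.Perm (Fin n) → L) where
  toFun f w :=
    swapCoeff Γ (k₀ (w (pos a))) (k₀ (w (posSucc a))) (x (w (pos a))) (x (w (posSucc a)))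
        * f (w * simpleTransposition a)
      + stayCoeff (k₀ (w (pos a))) (k₀ (w (posSucc a))) (x (w (pos a))) (x (w (posSucc a))) * f w
  map_add' f g := by ext w; simp only [Pi.add_apply]; ring
  map_smul' c f := by ext w; simp only [Pi.smul_apply, smul_eq_mul, RingHom.id_apply]; ring

/-- The action of `y_b`, a multiplication operator. -/
def repY (b : Fin n) : Module.End L (Equiv.Perm (Fin n) → L) where
  toFun f w := x (w b) * f w
  map_add' f g := by ext w; simp only [Pi.add_apply]; ring
  map_smul' c f := by ext w; simp only [Pi.smul_apply, smul_eq_mul, RingHom.id_apply]; ring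

open Classical in
/-- The action of `e(k)`, a projection. -/
def repE (k : Fin n → K) : Module.End L (Equiv.Perm (Fin n) → L) where
  toFun f w := if k₀ ∘ w = k then f w else 0
  map_add' f g := by ext w; simp only [Pi.add_apply]; split_ifs <;> simp
  map_smul' c f := by
    ext w
    simp only [Pi.smul_apply, smul_eq_mul, RingHom.id_apply]
    split_ifs <;> simp

/-- The images of the generators in the representation. -/
def repGen : Gen n β → Module.End L (Equiv.Perm (Fin n) → L)
  | Gen.e k => repE k₀ k.1
  | Gen.y b => repY x b
  | Gen.psi a => repPsi Γ k₀ x a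

variable {Γ k₀ x}

theorem repPsi_apply (a : Fin (n - 1)) (f : Equiv.Perm (Fin n) → L) (w : Equiv.Perm (Fin n)) :
    repPsi Γ k₀ x a f w =
      swapCoeff Γ (k₀ (w (pos a))) (k₀ (w (posSucc a))) (x (w (pos a))) (x (w (posSucc a)))
        * f (w * simpleTransposition a)
      + stayCoeff (k₀ (w (pos a))) (k₀ (w (posSucc a))) (x (w (pos a))) (x (w (posSucc a)))
        * f w := rfl

theorem repY_apply (b : Fin n) (f : Equiv.Perm (Fin n) → L) (w : Equiv.Perm (Fin n)) :
    repY x b f w = x (w b) * f w := rfl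

open Classical in
theorem repE_apply (k : Fin n → K) (f : Equiv.Perm (Fin n) → L) (w : Equiv.Perm (Fin n)) :
    repE k₀ k f w = if k₀ ∘ w = k then f w else 0 := rfl

theorem comp_mem_tuples {k : Fin n → K} (hk : k ∈ tuples n β) (w : Equiv.Perm (Fin n)) :
    k ∘ w ∈ tuples n β := fun y => by
  rw [← hk y]
  exact Set.ncard_preimage_of_injective_subset_range (s := {b | k b = y})
      w.injective (by simp [w.surjective.range_eq])

theorem repPsi_sq_apply (hx : Function.Injective x) (a : Fin (n - 1))
    (f : Equiv.Perm (Fin n) → L) (w : Equiv.Perm (Fin n)) :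
    repPsi Γ k₀ x a (repPsi Γ k₀ x a f) w =
      sqCoeff Γ (k₀ (w (pos a))) (k₀ (w (posSucc a))) (x (w (pos a))) (x (w (posSucc a)))
        * f w := by
  simp only [repPsi_apply, Equiv.Perm.mul_apply, simpleTransposition_pos,
    simpleTransposition_posSucc, mul_assoc, simpleTransposition_mul_self, mul_one]
  exact sqCoeff_identity _ _ (hx.ne (w.injective.ne (pos_ne_posSucc a))) _ _

theorem repPsi_braid_apply (hΓ : ∀ k, ¬ Γ.Adj k k) (hx : Function.Injective x)
    {a b : Fin (n - 1)} (hab : (b : ℕ) = a + 1)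
    (f : Equiv.Perm (Fin n) → L) (w : Equiv.Perm (Fin n)) :
    repPsi Γ k₀ x b (repPsi Γ k₀ x a (repPsi Γ k₀ x b f)) w =
      repPsi Γ k₀ x a (repPsi Γ k₀ x b (repPsi Γ k₀ x a f)) w
        + braidCoeff Γ (k₀ (w (pos a))) (k₀ (w (posSucc a))) (k₀ (w (posSucc b)))
          (x (w (pos a))) (x (w (posSucc a))) (x (w (posSucc b))) * f w := by
  have h1 : simpleTransposition a (posSucc b) = posSucc b :=
    simpleTransposition_of_ne (by simp [posSucc, pos, Fin.ext_iff]; omega)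
      (by simp [posSucc, Fin.ext_iff]; omega)
  have h2 : simpleTransposition b (pos a) = pos a :=
    simpleTransposition_of_ne (by simp [pos, Fin.ext_iff]; omega)
      (by simp [pos, posSucc, Fin.ext_iff]; omega)
  have h3 : simpleTransposition a (pos b) = pos a := by
    rw [← posSucc_eq_pos hab, simpleTransposition_posSucc]
  have h4 : pos a ≠ pos b := by simp [pos, Fin.ext_iff]; omega
  have h5 : pos a ≠ posSucc b := by simp [posSucc, pos, Fin.ext_iff]; omega
  have hc : w * (simpleTransposition b * (simpleTransposition a * simpleTransposition b))
      = w * (simpleTransposition a * (simpleTransposition b * simpleTransposition a)) := by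
    rw [← mul_assoc (simpleTransposition b), ← mul_assoc (simpleTransposition a),
      simpleTransposition_braid hab]
  simp only [repPsi_apply, Equiv.Perm.mul_apply, simpleTransposition_pos, posSucc_eq_pos hab,
    simpleTransposition_posSucc, h1, h2, h3, mul_assoc, simpleTransposition_mul_self, mul_one, hc]
  exact braidCoeff_identity hΓ _ _ _ (hx.ne (w.injective.ne h4))
    (hx.ne (w.injective.ne (pos_ne_posSucc b))) (hx.ne (w.injective.ne h5)) _ _ _ _ _ _

theorem repPsi_comm {a b : Fin (n - 1)} (h : (a : ℕ) + 1 < b ∨ (b : ℕ) + 1 < a)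
    (f : Equiv.Perm (Fin n) → L) (w : Equiv.Perm (Fin n)) :
    repPsi Γ k₀ x a (repPsi Γ k₀ x b f) w = repPsi Γ k₀ x b (repPsi Γ k₀ x a f) w := by
  have h1 : simpleTransposition a (posSucc b) = posSucc b :=
    simpleTransposition_of_ne (by simp [posSucc, pos, Fin.ext_iff]; omega)
      (by simp [posSucc, Fin.ext_iff]; omega)
  have h2 : simpleTransposition a (pos b) = pos b :=
    simpleTransposition_of_ne (by simp [pos, Fin.ext_iff]; omega)
      (by simp [posSucc, pos, Fin.ext_iff]; omega)
  have h3 : simpleTransposition b (posSucc a) = posSucc a :=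
    simpleTransposition_of_ne (by simp [posSucc, pos, Fin.ext_iff]; omega)
      (by simp [posSucc, Fin.ext_iff]; omega)
  have h4 : simpleTransposition b (pos a) = pos a :=
    simpleTransposition_of_ne (by simp [pos, Fin.ext_iff]; omega)
      (by simp [posSucc, pos, Fin.ext_iff]; omega)
  simp only [repPsi_apply, Equiv.Perm.mul_apply, h1, h2, h3, h4, mul_assoc,
    simpleTransposition_comm h]
  ring

open Classical in
theorem repPsi_repY_posSucc (hx : Function.Injective x) (a : Fin (n - 1))
    (f : Equiv.Perm (Fin n) → L) (w : Equiv.Perm (Fin n)) :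
    repPsi Γ k₀ x a (repY x (posSucc a) f) w = repY x (pos a) (repPsi Γ k₀ x a f) w
      + if k₀ (w (pos a)) = k₀ (w (posSucc a)) then f w else 0 := by
  have h := sub_ne_zero.2 (hx.ne (w.injective.ne (pos_ne_posSucc a).symm))
  simp only [repPsi_apply, repY_apply, Equiv.Perm.mul_apply, simpleTransposition_posSucc,
    stayCoeff]
  split_ifs
  · field_simp
    ring
  · ring

open Classical in
theorem repY_posSucc_repPsi (hx : Function.Injective x) (a : Fin (n - 1))
    (f : Equiv.Perm (Fin n) → L) (w : Equiv.Perm (Fin n)) :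
    repY x (posSucc a) (repPsi Γ k₀ x a f) w = repPsi Γ k₀ x a (repY x (pos a) f) w
      + if k₀ (w (pos a)) = k₀ (w (posSucc a)) then f w else 0 := by
  have h := sub_ne_zero.2 (hx.ne (w.injective.ne (pos_ne_posSucc a).symm))
  simp only [repPsi_apply, repY_apply, Equiv.Perm.mul_apply, simpleTransposition_pos,
    stayCoeff]
  split_ifs
  · field_simp
    ring
  · ring

end Representation

section RepRelations

variable {K : Type*} {F : Type*} [Field F] {Γ : Digraph K}
variable {L : Type*} [Field L] [Algebra F L] {n : ℕ} {β : K →₀ ℕ}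
variable {k₀ : Fin n → K} {x : Fin n → L}

/-- The operators satisfy the defining relations. A factor `e(k)` on the right restricts each
relation to the points whose tuple of labels is `k`. -/
theorem rel_rep (hΓ : ∀ k, ¬ Γ.Adj k k) (hk₀ : k₀ ∈ tuples n β) (hx : Function.Injective x)
    {z z' : FreeAlgebra F (Gen n β)} (h : Rel F Γ z z') :
    FreeAlgebra.lift F (repGen Γ k₀ x) z = FreeAlgebra.lift F (repGen (β := β) Γ k₀ x) z' := by
  classical
  refine LinearMap.ext fun f => funext fun w => ?_
  cases h
  case sum_e =>
    simp only [map_sum, map_one, FreeAlgebra.lift_ι_apply, repGen, LinearMap.sum_apply,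
      Finset.sum_apply, repE_apply, Module.End.one_apply]
    rw [Finset.sum_eq_single ⟨k₀ ∘ w, comp_mem_tuples hk₀ w⟩]
    · simp
    · intro k _ hk
      exact if_neg fun hc => hk (Subtype.ext hc.symm)
    · simp
  case e_mul_self k =>
    simp only [map_mul, FreeAlgebra.lift_ι_apply, repGen, Module.End.mul_apply, repE_apply]
    split_ifs <;> rfl
  case e_mul_ne k k' hk =>
    simp only [map_mul, map_zero, FreeAlgebra.lift_ι_apply, repGen, Module.End.mul_apply,
      repE_apply, LinearMap.zero_apply, Pi.zero_apply]
    split_ifs with h1 h2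
    · exact absurd (Subtype.ext (h1.symm.trans h2)) hk
    · rfl
    · rfl
  case y_e a k =>
    simp only [map_mul, FreeAlgebra.lift_ι_apply, repGen, Module.End.mul_apply, repE_apply,
      repY_apply, mul_ite, mul_zero]
  case psi_e a k =>
    simp only [map_mul, FreeAlgebra.lift_ι_apply, repGen, Module.End.mul_apply, repE_apply,
      repPsi_apply]
    have h1 : k₀ ∘ (w * simpleTransposition a) = k.1 ↔ k₀ ∘ w = (swapTuple a k).1 := by
      constructor <;> intro h2 <;> ext c
      · simp [swapTuple, ← h2]
      · have := congrFun h2 (simpleTransposition a c)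
        simpa [swapTuple] using this
    by_cases h3 : k₀ (w (pos a)) = k₀ (w (posSucc a))
    · have h4 : k₀ ∘ w = (swapTuple a k).1 ↔ k₀ ∘ w = k.1 := by
        rw [← h1]
        have : k₀ ∘ (w * simpleTransposition a) = k₀ ∘ w := by
          ext c
          by_cases hc : c = pos a
          · simp [hc, h3]
          · by_cases hc' : c = posSucc a
            · simp [hc', h3]
            · simp [simpleTransposition_of_ne hc hc']
        rw [this]
      simp only [h1, h4]
      split_ifs <;> simp
    · simp only [h1, stayCoeff, if_neg h3, zero_mul, add_zero, mul_ite, mul_zero, ite_self]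
  case y_y a b =>
    simp only [map_mul, FreeAlgebra.lift_ι_apply, repGen, Module.End.mul_apply, repY_apply]
    ring
  case psi_y a b h h' =>
    simp only [map_mul, FreeAlgebra.lift_ι_apply, repGen, Module.End.mul_apply, repY_apply,
      repPsi_apply, Equiv.Perm.mul_apply, simpleTransposition_of_ne h h']
    ring
  case psi_psi a b h =>
    simp only [map_mul, FreeAlgebra.lift_ι_apply, repGen, Module.End.mul_apply]
    exact repPsi_comm h f w
  case psi_y_succ_eq a k h | psi_y_succ_ne a k h =>
    simp only [map_mul, map_add, map_one, FreeAlgebra.lift_ι_apply, repGen,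
      Module.End.mul_apply, LinearMap.add_apply, Module.End.one_apply, Pi.add_apply,
      repPsi_repY_posSucc hx, repE_apply]
    by_cases hk : k₀ ∘ w = k.1
    · simp only [← hk, Function.comp_apply] at h
      simp [h]
    · simp [hk]
  case y_succ_psi_eq a k h | y_succ_psi_ne a k h =>
    simp only [map_mul, map_add, map_one, FreeAlgebra.lift_ι_apply, repGen,
      Module.End.mul_apply, LinearMap.add_apply, Module.End.one_apply, Pi.add_apply,
      repY_posSucc_repPsi hx, repE_apply]
    by_cases hk : k₀ ∘ w = k.1
    · simp only [← hk, Function.comp_apply] at h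
      simp [h]
    · simp [hk]
  case psi_sq_eq a k h | psi_sq_noEdge a k hne h | psi_sq_right a k h | psi_sq_left a k h
    | psi_sq_double a k h =>
    simp only [map_mul, map_sub, map_zero, pow_two, FreeAlgebra.lift_ι_apply, repGen,
      Module.End.mul_apply, repPsi_sq_apply hx, repE_apply, repY_apply, LinearMap.sub_apply,
      Pi.sub_apply, LinearMap.zero_apply, Pi.zero_apply]
    split_ifs with hk
    · simp only [← hk, Function.comp_apply, Arrow, DoubleArrow, NoEdge] at *
      have hij : ∀ i j : K, Γ.Adj i j → i ≠ j := fun i j h h' => hΓ i (by rwa [← h'] at h)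
      simp only [sqCoeff]
      split_ifs <;> first | ring1 | grind
    · simp
  case braid_right a b hab k h h' | braid_left a b hab k h h' | braid_double a b hab k h h'
    | braid_other a b hab k h =>
    simp only [map_mul, map_add, map_sub, map_one, two_mul, FreeAlgebra.lift_ι_apply, repGen,
      Module.End.mul_apply, repPsi_braid_apply hΓ hx hab, repE_apply, repY_apply,
      LinearMap.sub_apply, LinearMap.add_apply, Pi.add_apply, Pi.sub_apply, Module.End.one_apply]
    split_ifs with hk
    · simp only [← hk, Function.comp_apply, Arrow, DoubleArrow] at *
      simp only [braidCoeff]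
      split_ifs <;> first | ring1 | grind
    · simp

end RepRelations

/-! ### Linear independence -/

section Independence

variable {K : Type*} {F : Type*} [Field F] {Γ : Digraph K}
variable {L : Type*} [Field L] [Algebra F L] {n : ℕ} {β : K →₀ ℕ}
variable {k₀ : Fin n → K} {x : Fin n → L}

/-- The representation of the quiver Hecke algebra on functions on the orbit of `(k₀, x)`. -/
def repHom (hΓ : ∀ k, ¬ Γ.Adj k k) (hk₀ : k₀ ∈ tuples n β) (hx : Function.Injective x) :
    QHAlgebra F Γ n β →ₐ[F] Module.End L (Equiv.Perm (Fin n) → L) :=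
  RingQuot.liftAlgHom F ⟨FreeAlgebra.lift F (repGen Γ k₀ x), fun _ _ h => rel_rep hΓ hk₀ hx h⟩

section repHom

variable (hΓ : ∀ k, ¬ Γ.Adj k k) (hk₀ : k₀ ∈ tuples n β) (hx : Function.Injective x)

theorem repHom_genPsi (a : Fin (n - 1)) :
    repHom (F := F) hΓ hk₀ hx (genPsi F Γ a) = repPsi Γ k₀ x a := by
  simp [repHom, genPsi, gen, repGen]

theorem repHom_genY (a : Fin n) : repHom (F := F) hΓ hk₀ hx (genY F Γ a) = repY x a := by
  simp [repHom, genY, gen, repGen]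

theorem repHom_genE (k : tuples n β) :
    repHom (F := F) hΓ hk₀ hx (genE F Γ k) = repE k₀ k.1 := by
  simp [repHom, genE, gen, repGen]

theorem repHom_wordProd (l : List (Fin (n - 1))) :
    repHom (F := F) hΓ hk₀ hx (wordProd (genPsi F Γ) l) = wordProd (repPsi Γ k₀ x) l := by
  induction l with
  | nil => simp
  | cons a l ih => rw [wordProd_cons, wordProd_cons, map_mul, ih, repHom_genPsi]

end repHom

theorem repE_single : repE k₀ k₀ (Pi.single 1 1 : Equiv.Perm (Fin n) → L) = Pi.single 1 1 := by
  ext w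
  rw [repE_apply]
  by_cases h : w = 1
  · subst h
    simp
  · simp [h]

/-- The function concentrated at the identity is an eigenvector of the `y_a`. -/
theorem monomialProd_repY_single (m : Fin n → ℕ) :
    monomialProd (repY x) m (Pi.single 1 1 : Equiv.Perm (Fin n) → L)
      = (∏ a, x a ^ m a) • Pi.single 1 1 := by
  have hy : ∀ a, repY x a (Pi.single 1 1 : Equiv.Perm (Fin n) → L) = x a • Pi.single 1 1 := by
    intro a
    ext w
    rw [repY_apply]
    by_cases h : w = 1
    · subst h
      simp
    · simp [h]
  have hpow : ∀ a (r : ℕ), (repY x a ^ r) (Pi.single 1 1 : Equiv.Perm (Fin n) → L)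
      = x a ^ r • Pi.single 1 1 := by
    intro a r
    induction r with
    | zero => simp
    | succ r ih => rw [pow_succ', Module.End.mul_apply, ih, map_smul, hy, smul_smul, pow_succ]
  have hlist : ∀ l : List (Fin n), (l.map fun a => repY x a ^ m a).prod
      (Pi.single 1 1 : Equiv.Perm (Fin n) → L)
        = (l.map fun a => x a ^ m a).prod • Pi.single 1 1 := by
    intro l
    induction l with
    | nil => simp
    | cons a l ih =>
      simp only [List.map_cons, List.prod_cons, Module.End.mul_apply, ih, map_smul, hpow,
        smul_smul]
      rw [mul_comm]
  rw [monomialProd, List.ofFn_eq_map, hlist, ← List.ofFn_eq_map, List.prod_ofFn]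

/-- The values of `ψ_l δ₁`, where `δ₁` is concentrated at the identity, are supported on inverses of
permutations of subwords of `l`. -/
theorem exists_sublist_of_wordProd_ne_zero {l : List (Fin (n - 1))} {v : Equiv.Perm (Fin n)}
    (h : wordProd (repPsi Γ k₀ x) l (Pi.single 1 1) v ≠ 0) :
    ∃ l' : List (Fin (n - 1)), l'.Sublist l ∧ wordPerm l' = v⁻¹ := by
  induction l generalizing v with
  | nil =>
    refine ⟨[], List.Sublist.refl _, ?_⟩
    have : v = 1 := by
      by_contra hv
      simp [hv] at h
    simp [this]
  | cons a l ih =>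
    rw [wordProd_cons, Module.End.mul_apply, repPsi_apply] at h
    by_cases h1 : wordProd (repPsi Γ k₀ x) l (Pi.single 1 1) (v * simpleTransposition a) = 0
    · rw [h1, mul_zero, zero_add] at h
      obtain ⟨l', hl', hv⟩ := ih (right_ne_zero_of_mul h)
      exact ⟨l', hl'.cons a, hv⟩
    · obtain ⟨l', hl', hv⟩ := ih h1
      exact ⟨a :: l', hl'.cons_cons a, by simp [hv]⟩

theorem wordPerm_eq_of_wordProd_ne_zero {l : List (Fin (n - 1))} {v : Equiv.Perm (Fin n)}
    (h : wordProd (repPsi Γ k₀ x) l (Pi.single 1 1) v ≠ 0) :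
    invNum v⁻¹ < l.length ∨ wordPerm l = v⁻¹ := by
  obtain ⟨l', hl', hv⟩ := exists_sublist_of_wordProd_ne_zero h
  rcases hl'.length_le.lt_or_eq with h1 | h1
  · exact Or.inl ((hv ▸ invNum_wordPerm_le l').trans_lt h1)
  · exact Or.inr (hl'.eq_of_length h1 ▸ hv)

/-- The leading value of `ψ_l δ₁` for a reduced word `l` is a product of coefficients of simple
transpositions, hence nonzero. -/
theorem wordProd_leading_ne_zero (hx : Function.Injective x) {l : List (Fin (n - 1))}
    (hl : invNum (wordPerm l) = l.length) :
    wordProd (repPsi Γ k₀ x) l (Pi.single 1 1) (wordPerm l)⁻¹ ≠ 0 := by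
  induction l with
  | nil => simp
  | cons a l ih =>
    have h1 := invNum_wordPerm_le l
    have h2 := invNum_mul_le a (wordPerm l)
    simp only [wordPerm_cons, List.length_cons] at hl
    have h3 : wordProd (repPsi Γ k₀ x) l (Pi.single 1 1)
        (simpleTransposition a * wordPerm l)⁻¹ = 0 := by
      by_contra h
      obtain ⟨l', hl', hv⟩ := exists_sublist_of_wordProd_ne_zero h
      have h4 := invNum_wordPerm_le l'
      rw [hv, inv_inv] at h4
      have := hl'.length_le
      omega
    rw [wordProd_cons, Module.End.mul_apply, repPsi_apply, wordPerm_cons, h3, mul_zero, add_zero]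
    refine mul_ne_zero (swapCoeff_ne_zero _ _
      (hx.ne ((Equiv.injective _).ne (pos_ne_posSucc a)))) ?_
    simpa [mul_assoc] using ih (by omega)

/-- The functions `ψ_w δ₁` are triangular with respect to the length, with nonzero diagonal
entries. -/
theorem linearIndependent_wordProd (hx : Function.Injective x)
    {red : Equiv.Perm (Fin n) → List (Fin (n - 1))}
    (hred : ∀ w, wordPerm (red w) = w) (hlen : ∀ w, (red w).length = invNum w) :
    LinearIndependent L fun w =>
      wordProd (repPsi Γ k₀ x) (red w) (Pi.single 1 1 : Equiv.Perm (Fin n) → L) := by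
  classical
  rw [Fintype.linearIndependent_iff]
  intro p hp
  by_contra! hc
  obtain ⟨w₁, hw₁⟩ := hc
  -- A permutation of maximal length with a nonzero coefficient.
  obtain ⟨w₀, hw₀, hmax⟩ := Finset.exists_max_image (Finset.univ.filter fun w => p w ≠ 0) invNum
    ⟨w₁, by simpa using hw₁⟩
  simp only [Finset.mem_filter, Finset.mem_univ, true_and] at hw₀ hmax
  have h := congrFun hp w₀⁻¹
  rw [Finset.sum_apply, Finset.sum_eq_single w₀] at h
  · have := wordProd_leading_ne_zero (Γ := Γ) (k₀ := k₀) hx (l := red w₀) (by rw [hred, hlen])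
    rw [hred] at this
    exact mul_ne_zero hw₀ this h
  · intro w _ hw
    by_contra hne
    rcases wordPerm_eq_of_wordProd_ne_zero (right_ne_zero_of_mul hne) with h1 | h1
    · rw [inv_inv, hlen] at h1
      exact absurd (hmax w (left_ne_zero_of_mul hne)) (by omega)
    · rw [hred, inv_inv] at h1
      exact hw h1
  · simp

theorem linearIndependent_monomials (hx : AlgebraicIndependent F x) :
    LinearIndependent F fun m : Fin n → ℕ => ∏ a, x a ^ m a := by
  have h := (MvPolynomial.basisMonomials (Fin n) F).linearIndependent.map'
    (MvPolynomial.aeval x : MvPolynomial (Fin n) F →ₐ[F] L).toLinearMap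
    (LinearMap.ker_eq_bot.2 hx)
  have h' := h.comp _ (Finsupp.equivFunOnFinite (α := Fin n) (M := ℕ)).symm.injective
  have e : (fun m : Fin n → ℕ => ∏ a, x a ^ m a) = ((MvPolynomial.aeval x).toLinearMap ∘
      MvPolynomial.basisMonomials (Fin n) F) ∘ Finsupp.equivFunOnFinite.symm := by
    ext m
    simp [MvPolynomial.aeval_monomial, Finsupp.prod_fintype]
  rw [e]
  exact h'

/-- The independence half of the basis theorem for the quiver Hecke algebra. -/
theorem linearIndependent_wordProd_mul (hΓ : ∀ k, ¬ Γ.Adj k k)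
    {red : Equiv.Perm (Fin n) → List (Fin (n - 1))}
    (hred : ∀ w, IsReducedExpression w (red w)) (k : tuples n β) :
    LinearIndependent F fun i : Equiv.Perm (Fin n) × (Fin n → ℕ) =>
      wordProd (genPsi F Γ) (red i.1) * monomialProd (genY F Γ) i.2 * genE F Γ k := by
  set x : Fin n → FractionRing (MvPolynomial (Fin n) F) :=
    fun i => algebraMap (MvPolynomial (Fin n) F) _ (MvPolynomial.X i) with hxdef
  have hx : AlgebraicIndependent F x :=
    (MvPolynomial.algebraicIndependent_X (Fin n) F).map' (f := IsScalarTower.toAlgHom F _ _)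
      (IsFractionRing.injective (MvPolynomial (Fin n) F) _)
  have hinj := hx.injective
  set ρ := repHom (F := F) hΓ k.2 hinj
  have h1 := linearIndependent_smul (linearIndependent_monomials hx)
    (linearIndependent_wordProd (Γ := Γ) (k₀ := k.1) hinj
      (fun w => (hred w).wordPerm_eq) fun w => (hred w).length_eq)
  have h2 := h1.comp Prod.swap Prod.swap_injective
  set φ := (LinearMap.applyₗ (R := FractionRing (MvPolynomial (Fin n) F))
    (Pi.single 1 1)).restrictScalars F ∘ₗ ρ.toLinearMap
  refine LinearIndependent.of_comp φ ?_
  have e : (φ ∘ fun i : Equiv.Perm (Fin n) × (Fin n → ℕ) =>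
      wordProd (genPsi F Γ) (red i.1) * monomialProd (genY F Γ) i.2 * genE F Γ k)
      = (fun p : (Fin n → ℕ) × Equiv.Perm (Fin n) => (∏ a, x a ^ p.1 a) •
        wordProd (repPsi Γ k.1 x) (red p.2) (Pi.single 1 1)) ∘ Prod.swap := by
    funext i
    have hmon : ρ (monomialProd (genY F Γ) i.2) = monomialProd (repY x) i.2 := by
      rw [monomialProd, monomialProd, map_list_prod, List.map_ofFn]
      congr 2
      ext a : 1
      simp only [Function.comp_apply, map_pow, ρ, repHom_genY]
    simp only [φ, Function.comp_apply, LinearMap.comp_apply, AlgHom.toLinearMap_apply, map_mul,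
      hmon, LinearMap.restrictScalars_apply, LinearMap.applyₗ_apply_apply, Module.End.mul_apply,
      Prod.fst_swap, Prod.snd_swap]
    rw [repHom_genE, repE_single, monomialProd_repY_single, map_smul, repHom_wordProd]
  rw [e]
  exact h2

end Independence

/-! ### The fixed points in the algebra of an orbit -/

section OrbitBasis

variable {K : Type*} {F : Type*} [Field F] {Γ : Digraph K} {σ : QuiverAut Γ} {n : ℕ} {α : K →₀ ℕ}

theorem orbPsiWord_apply (l : List (Fin (n - 1))) (β : orbit σ α) :
    orbPsiWord σ F l β = wordProd (genPsi F Γ) l := by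
  rw [orbPsiWord, Pi.list_prod_apply, List.map_map]
  rfl

theorem orbYMonomial_apply (m : Fin n → ℕ) (β : orbit σ α) :
    orbYMonomial σ F m β = monomialProd (genY F Γ) m := by
  rw [orbYMonomial, Pi.list_prod_apply, List.map_ofFn]
  rfl

theorem tuples_unique {β β' : K →₀ ℕ} {k : Fin n → K} (h : k ∈ tuples n β)
    (h' : k ∈ tuples n β') : β = β' := by
  ext y
  rw [← h y, h' y]

open Classical in
theorem orbE_apply (k : orbitTuples σ n α) (β : orbit σ α) :
    orbE σ F k β = if h : k.1 ∈ tuples n β.1 then genE F Γ ⟨k.1, h⟩ else 0 := rfl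

theorem orbE_apply_of_mem {k : orbitTuples σ n α} {β : orbit σ α} (h : k.1 ∈ tuples n β.1) :
    orbE σ F k β = genE F Γ ⟨k.1, h⟩ := by
  rw [orbE_apply, dif_pos h]

theorem orbE_apply_of_notMem {k : orbitTuples σ n α} {β : orbit σ α} (h : k.1 ∉ tuples n β.1) :
    orbE σ F k β = 0 := by
  rw [orbE_apply, dif_neg h]

theorem exists_mem_tuples (k : orbitTuples σ n α) : ∃ β : orbit σ α, k.1 ∈ tuples n β.1 := by
  obtain ⟨β, hβ, hk⟩ := Set.mem_iUnion₂.1 k.2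
  exact ⟨⟨β, hβ⟩, hk⟩

theorem mem_orbitTuples {β : orbit σ α} {k : Fin n → K} (h : k ∈ tuples n β.1) :
    k ∈ orbitTuples σ n α := Set.mem_iUnion₂.2 ⟨β.1, β.2, h⟩

open Classical in
theorem orbE_mul_orbE (k k' : orbitTuples σ n α) :
    orbE σ F k * orbE σ F k' = if k = k' then orbE σ F k' else 0 := by
  ext β
  rw [Pi.mul_apply]
  by_cases hk : k.1 ∈ tuples n β.1
  · by_cases hk' : k'.1 ∈ tuples n β.1
    · rw [orbE_apply_of_mem hk, orbE_apply_of_mem hk']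
      split_ifs with h
      · subst h
        rw [orbE_apply_of_mem hk, genE_mul_self]
      · exact genE_mul_ne F Γ fun h' => h (Subtype.ext (Subtype.mk.inj h'))
    · rw [orbE_apply_of_notMem hk', mul_zero]
      split_ifs
      · exact (orbE_apply_of_notMem hk').symm
      · rfl
  · rw [orbE_apply_of_notMem hk, zero_mul]
    split_ifs with h
    · exact (orbE_apply_of_notMem (h ▸ hk)).symm
    · rfl

theorem sum_orbE [Fintype (orbitTuples σ n α)] : ∑ k : orbitTuples σ n α, orbE σ F k = 1 := by
  classical
  ext β
  rw [Finset.sum_apply, Pi.one_apply, ← sum_genE]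
  symm
  refine Finset.sum_of_injOn (fun k => ⟨k.1, mem_orbitTuples k.2⟩) ?_ (by simp) ?_ ?_
  · intro k _ k' _ h
    exact Subtype.ext (Subtype.mk.inj h)
  · intro k _ hk
    refine orbE_apply_of_notMem fun h => hk ?_
    exact ⟨⟨k.1, h⟩, by simp, rfl⟩
  · intro k _
    exact (orbE_apply_of_mem (k := ⟨k.1, mem_orbitTuples k.2⟩) k.2).symm

theorem orbitSigma_orbE (k : orbitTuples σ n α) :
    orbitSigma σ F n α (orbE σ F k) = orbE σ F (actOrbitTuple σ k) := by
  ext β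
  change sigmaHom σ F (orbitPred_spec σ β) (orbE σ F k (orbitPred σ β)) = _
  by_cases hk : k.1 ∈ tuples n (orbitPred σ β).1
  · have hk' : (actOrbitTuple σ k).1 ∈ tuples n β.1 := by
      rw [orbitPred_spec σ β]
      exact actTuple_mem σ hk
    rw [orbE_apply_of_mem hk, orbE_apply_of_mem hk', genE, sigmaHom_gen]
    rfl
  · have hk' : (actOrbitTuple σ k).1 ∉ tuples n β.1 := by
      intro h
      apply hk
      have := ((tupleEquiv σ (orbitPred_spec σ β)).symm ⟨_, h⟩).2
      convert this using 1
      ext a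
      simp [tupleEquiv, actTuple, actOrbitTuple]
    rw [orbE_apply_of_notMem hk, orbE_apply_of_notMem hk', map_zero]

theorem orbitSigma_orbPsiWord (l : List (Fin (n - 1))) :
    orbitSigma σ F n α (orbPsiWord σ F l) = orbPsiWord σ F l := by
  have h : ∀ a, orbitSigma σ F n α (orbPsi σ F a) = orbPsi σ F a := fun a => by
    ext β
    exact sigmaHom_gen σ F (orbitPred_spec σ β) (Gen.psi a)
  rw [orbPsiWord, map_list_prod, List.map_map]
  congr 2
  exact funext h

theorem orbitSigma_orbYMonomial (m : Fin n → ℕ) :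
    orbitSigma σ F n α (orbYMonomial σ F m) = orbYMonomial σ F m := by
  have h : ∀ a, orbitSigma σ F n α (orbY σ F a) = orbY σ F a := fun a => by
    ext β
    exact sigmaHom_gen σ F (orbitPred_spec σ β) (Gen.y a)
  rw [orbYMonomial, map_list_prod, List.map_ofFn]
  congr 2
  funext a
  rw [Function.comp_apply, map_pow, h]

theorem actOrbitTuple_iterate (j : ℕ) (k : orbitTuples σ n α) :
    ((actOrbitTuple σ)^[j] k).1 = actTuple (σ ^ j) k.1 := by
  induction j with
  | zero => rfl
  | succ j ih =>
    rw [Function.iterate_succ_apply', pow_succ']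
    ext a
    change σ (((actOrbitTuple σ)^[j] k).1 a) = _
    rw [ih]
    rfl

theorem actOrbitTuple_iterate_eq_self {p : ℕ} (hσ : σ ^ p = 1) (k : orbitTuples σ n α) :
    (actOrbitTuple σ)^[p] k = k := by
  refine Subtype.ext ?_
  rw [actOrbitTuple_iterate, hσ]
  rfl

theorem actOrbitTuple_injective :
    Function.Injective (actOrbitTuple σ : orbitTuples σ n α → orbitTuples σ n α) := by
  intro k k' h
  refine Subtype.ext (funext fun a => σ.injective ?_)
  exact congrFun (congrArg Subtype.val h) a

/-- The orbit of the tuple `k` under `σ`. -/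
def tupleClass (k : orbitTuples σ n α) : TupleClass σ n α := Quot.mk _ k

theorem tupleClass_surjective :
    Function.Surjective (tupleClass : orbitTuples σ n α → TupleClass σ n α) := Quot.mk_surjective

theorem tupleClass_actOrbitTuple (k : orbitTuples σ n α) :
    tupleClass (actOrbitTuple σ k) = tupleClass k :=
  (Quot.sound (r := fun k k' : orbitTuples σ n α => k' = actOrbitTuple σ k) rfl).symm

open Classical in
theorem orbClassE_eq_sum [Fintype (orbitTuples σ n α)] (γ : TupleClass σ n α) :
    orbClassE σ F γ = ∑ k : orbitTuples σ n α, if tupleClass k = γ then orbE σ F k else 0 := by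
  rw [orbClassE, finsum_eq_sum_of_fintype, ← Finset.sum_filter]
  refine (Finset.sum_subtype _ (fun k => ?_) _).symm
  rw [Finset.mem_filter, and_iff_right (Finset.mem_univ k)]
  rfl

theorem orbitSigma_orbClassE [Fintype (orbitTuples σ n α)] (γ : TupleClass σ n α) :
    orbitSigma σ F n α (orbClassE σ F γ) = orbClassE σ F γ := by
  classical
  rw [orbClassE_eq_sum, map_sum]
  have hbij := Finite.injective_iff_bijective.1 (actOrbitTuple_injective (σ := σ) (n := n) (α := α))
  rw [← Function.Bijective.sum_comp hbij
    fun k => if tupleClass k = γ then orbE σ F k else 0]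
  refine Finset.sum_congr rfl fun k _ => ?_
  rw [tupleClass_actOrbitTuple, apply_ite (orbitSigma σ F n α), map_zero, orbitSigma_orbE]

open Classical in
theorem orbClassE_mul_orbE [Fintype (orbitTuples σ n α)] (γ : TupleClass σ n α)
    (k : orbitTuples σ n α) :
    orbClassE σ F γ * orbE σ F k = if tupleClass k = γ then orbE σ F k else 0 := by
  rw [orbClassE_eq_sum, Finset.sum_mul, Finset.sum_eq_single k]
  · split_ifs
    · rw [orbE_mul_orbE, if_pos rfl]
    · rw [zero_mul]
  · intro k' _ hk
    split_ifs
    · rw [orbE_mul_orbE, if_neg hk]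
    · rw [zero_mul]
  · simp

variable (F σ) in
/-- The element `ψ_w y^m e(k)` of the algebra of the orbit, where the word `red w` is used
for `ψ_w`. -/
def orbMonomial (red : Equiv.Perm (Fin n) → List (Fin (n - 1))) (k : orbitTuples σ n α)
    (i : Equiv.Perm (Fin n) × (Fin n → ℕ)) : OrbitAlgebra σ F n α :=
  orbPsiWord σ F (red i.1) * orbYMonomial σ F i.2 * orbE σ F k

variable (F σ) in
/-- The element `ψ_w y^m e(γ)` of the algebra of the orbit. -/
def orbClassMonomial (red : Equiv.Perm (Fin n) → List (Fin (n - 1)))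
    (i : Equiv.Perm (Fin n) × (Fin n → ℕ) × TupleClass σ n α) : OrbitAlgebra σ F n α :=
  orbPsiWord σ F (red i.1) * orbYMonomial σ F i.2.1 * orbClassE σ F i.2.2

variable {red : Equiv.Perm (Fin n) → List (Fin (n - 1))}

theorem linearIndependent_orbMonomial (hΓ : ∀ k, ¬ Γ.Adj k k)
    (hred : ∀ w, IsReducedExpression w (red w)) (k : orbitTuples σ n α) :
    LinearIndependent F (orbMonomial F σ red k) := by
  obtain ⟨β, hβ⟩ := exists_mem_tuples k
  refine LinearIndependent.of_comp (LinearMap.proj β) ?_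
  have e : (LinearMap.proj (R := F) (φ := fun β : orbit σ α => QHAlgebra F Γ n β.1) β ∘
      orbMonomial F σ red k) = fun i => wordProd (genPsi F Γ) (red i.1) *
        monomialProd (genY F Γ) i.2 * genE F Γ ⟨k.1, hβ⟩ := by
    funext i
    simp only [Function.comp_apply, LinearMap.proj_apply, orbMonomial, Pi.mul_apply,
      orbPsiWord_apply, orbYMonomial_apply, orbE_apply_of_mem hβ]
  rw [e]
  exact linearIndependent_wordProd_mul hΓ hred _

theorem mul_orbE_mem_span (hred : ∀ w, IsReducedExpression w (red w))
    (z : OrbitAlgebra σ F n α) (k : orbitTuples σ n α) :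
    z * orbE σ F k ∈ Submodule.span F (Set.range (orbMonomial F σ red k)) := by
  classical
  obtain ⟨β, hβ⟩ := exists_mem_tuples k
  have hsingle : ∀ x : OrbitAlgebra σ F n α,
      x * orbE σ F k = LinearMap.single F (fun β : orbit σ α => QHAlgebra F Γ n β.1) β
        (x β * genE F Γ ⟨k.1, hβ⟩) := by
    intro x
    ext β'
    rw [Pi.mul_apply, LinearMap.single_apply]
    by_cases h : β' = β
    · subst h
      rw [Pi.single_eq_same, orbE_apply_of_mem hβ]
    · rw [Pi.single_eq_of_ne h, orbE_apply_of_notMem, mul_zero]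
      exact fun h' => h (Subtype.ext (tuples_unique h' hβ))
  have hz := Submodule.mem_map_of_mem (f := LinearMap.single F
    (fun β : orbit σ α => QHAlgebra F Γ n β.1) β) (mul_genE_mem_span hred (z β) ⟨k.1, hβ⟩)
  rw [← hsingle, Submodule.map_span, ← Set.range_comp] at hz
  refine Submodule.span_mono (Set.range_subset_range_iff_exists_comp.2 ⟨id, ?_⟩) hz
  funext i
  simp only [Function.comp_apply, orbMonomial, hsingle, Pi.mul_apply, orbPsiWord_apply,
    orbYMonomial_apply, id]

open Classical in
theorem orbClassMonomial_mul_orbE [Fintype (orbitTuples σ n α)]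
    (i : Equiv.Perm (Fin n) × (Fin n → ℕ) × TupleClass σ n α) (k : orbitTuples σ n α) :
    orbClassMonomial F σ red i * orbE σ F k
      = if tupleClass k = i.2.2 then orbMonomial F σ red k (i.1, i.2.1) else 0 := by
  rw [orbClassMonomial, mul_assoc, orbClassE_mul_orbE, mul_ite, mul_zero]
  rfl

theorem orbitSigma_orbClassMonomial [Fintype (orbitTuples σ n α)]
    (i : Equiv.Perm (Fin n) × (Fin n → ℕ) × TupleClass σ n α) :
    orbitSigma σ F n α (orbClassMonomial F σ red i) = orbClassMonomial F σ red i := by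
  rw [orbClassMonomial, map_mul, map_mul, orbitSigma_orbPsiWord, orbitSigma_orbYMonomial,
    orbitSigma_orbClassE]

theorem linearIndependent_orbClassMonomial [Fintype (orbitTuples σ n α)]
    (hΓ : ∀ k, ¬ Γ.Adj k k) (hred : ∀ w, IsReducedExpression w (red w)) :
    LinearIndependent F (orbClassMonomial (α := α) F σ red) := by
  classical
  rw [linearIndependent_iff]
  intro l hl
  ext ⟨w, m, γ⟩
  obtain ⟨k, rfl⟩ := tupleClass_surjective γ
  -- Right multiplication by `e(k)` keeps exactly the terms with the class of `k`.
  set f : Equiv.Perm (Fin n) × (Fin n → ℕ) →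
      Equiv.Perm (Fin n) × (Fin n → ℕ) × TupleClass σ n α :=
    fun j => (j.1, j.2, tupleClass k) with hf
  have hinj : Function.Injective f := by
    rintro ⟨w, m⟩ ⟨w', m'⟩ h
    simp only [hf, Prod.mk.injEq, and_true] at h
    rw [h.1, h.2]
  have key : LinearMap.mulRight F (orbE σ F k) ∘ₗ
        Finsupp.linearCombination F (orbClassMonomial (α := α) F σ red)
      = Finsupp.linearCombination F (orbMonomial F σ red k) ∘ₗ Finsupp.lcomapDomain f hinj := by
    refine Finsupp.lhom_ext fun i c => ?_
    simp only [LinearMap.comp_apply, Finsupp.linearCombination_single, LinearMap.mulRight_apply,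
      smul_mul_assoc, orbClassMonomial_mul_orbE]
    split_ifs with h
    · obtain ⟨w', m', γ'⟩ := i
      obtain rfl : tupleClass k = γ' := h
      have : Finsupp.lcomapDomain (R := F) f hinj (Finsupp.single (f (w', m')) c)
          = Finsupp.single (w', m') c := Finsupp.comapDomain_single f _ c _
      rw [this, Finsupp.linearCombination_single]
    · have : Finsupp.lcomapDomain (R := F) f hinj (Finsupp.single i c) = 0 := by
        ext j
        refine Finsupp.single_eq_of_ne ?_
        rintro rfl
        exact h rfl
      rw [this, map_zero, smul_zero]
  have h0 := LinearMap.congr_fun key l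
  rw [LinearMap.comp_apply, hl, map_zero, LinearMap.comp_apply] at h0
  have h1 := (linearIndependent_iff.1 (linearIndependent_orbMonomial hΓ hred k)) _ h0.symm
  exact DFunLike.congr_fun h1 (w, m)

/-- A fixed point killed by `e(k)` for one `k` in each class is zero. -/
theorem eq_zero_of_mul_orbE_eq_zero [Fintype (orbitTuples σ n α)] {p : ℕ} (hp : 0 < p)
    (hσ : σ ^ p = 1) {z : OrbitAlgebra σ F n α} (hz : orbitSigma σ F n α z = z)
    (h : ∀ γ : TupleClass σ n α, ∃ k, tupleClass k = γ ∧ z * orbE σ F k = 0) : z = 0 := by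
  have hstep : ∀ k, z * orbE σ F k = 0 → z * orbE σ F (actOrbitTuple σ k) = 0 := by
    intro k hk
    rw [← orbitSigma_orbE]
    conv_lhs => rw [← hz]
    rw [← map_mul, hk, map_zero]
  have hiter : ∀ (j : ℕ) k, z * orbE σ F k = 0 → z * orbE σ F ((actOrbitTuple σ)^[j] k) = 0 := by
    intro j
    induction j with
    | zero => exact fun k hk => hk
    | succ j ih => exact fun k hk => ih _ (hstep k hk)
  have hiff : ∀ k k' : orbitTuples σ n α, k' = actOrbitTuple σ k →
      (z * orbE σ F k = 0) = (z * orbE σ F k' = 0) := by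
    rintro k _ rfl
    refine propext ⟨hstep k, fun hk => ?_⟩
    have := hiter (p - 1) _ hk
    rwa [← Function.iterate_succ_apply, Nat.succ_eq_add_one, Nat.sub_add_cancel hp,
      actOrbitTuple_iterate_eq_self hσ] at this
  have hall : ∀ γ : TupleClass σ n α, Quot.lift (fun k => z * orbE σ F k = 0) hiff γ := by
    intro γ
    obtain ⟨k, rfl, hk⟩ := h γ
    exact hk
  rw [← mul_one z, ← sum_orbE, Finset.mul_sum]
  exact Finset.sum_eq_zero fun k _ => hall (tupleClass k)

theorem mem_span_orbClassMonomial [Fintype (orbitTuples σ n α)] {p : ℕ} (hp : 0 < p)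
    (hσ : σ ^ p = 1) (hred : ∀ w, IsReducedExpression w (red w)) {z : OrbitAlgebra σ F n α}
    (hz : orbitSigma σ F n α z = z) :
    z ∈ Submodule.span F (Set.range (orbClassMonomial (α := α) F σ red)) := by
  classical
  have : Fintype (TupleClass σ n α) := Fintype.ofSurjective _ tupleClass_surjective
  choose rep hrep using tupleClass_surjective (σ := σ) (n := n) (α := α)
  have hc := fun γ : TupleClass σ n α =>
    Finsupp.mem_span_range_iff_exists_finsupp.1 (mul_orbE_mem_span hred z (rep γ))
  choose c hc using hc
  -- The element with the same coefficients as `z` at one representative of each class.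
  set y : OrbitAlgebra σ F n α := ∑ γ : TupleClass σ n α,
    (c γ).sum fun j r => r • orbClassMonomial F σ red (j.1, j.2, γ) with hy
  have hyspan : y ∈ Submodule.span F (Set.range (orbClassMonomial (α := α) F σ red)) :=
    sum_mem fun γ _ => sum_mem fun j _ =>
      Submodule.smul_mem _ _ (Submodule.subset_span ⟨_, rfl⟩)
  have hyfix : orbitSigma σ F n α y = y := by
    simp only [hy, Finsupp.sum, map_sum, map_smul, orbitSigma_orbClassMonomial]
  have hyrep : ∀ γ : TupleClass σ n α,
      y * orbE σ F (rep γ) = z * orbE σ F (rep γ) := by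
    intro γ
    rw [hy, Finset.sum_mul, Finset.sum_eq_single γ, ← hc γ]
    · simp only [Finsupp.sum, Finset.sum_mul, smul_mul_assoc, orbClassMonomial_mul_orbE]
      simp only [hrep, if_true]
    · intro γ' _ hne
      simp only [Finsupp.sum, Finset.sum_mul, smul_mul_assoc, orbClassMonomial_mul_orbE]
      refine Finset.sum_eq_zero fun j _ => ?_
      rw [if_neg fun h => hne (h.symm.trans (hrep γ)), smul_zero]
    · simp
  have : z - y = 0 := eq_zero_of_mul_orbE_eq_zero hp hσ (by rw [map_sub, hz, hyfix])
    fun γ => ⟨rep γ, hrep γ, by rw [sub_mul, hyrep, sub_self]⟩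
  rwa [sub_eq_zero.1 this]

end OrbitBasis
end QuiverHecke
end

open QuiverHecke in
theorem mainTheorem7 {F K : Type*} [Field F] (Γ : Digraph K) (hΓ : ∀ k, ¬ Γ.Adj k k)
    (p : ℕ) (hp : 1 ≤ p) (σ : QuiverAut Γ) (hσ : σ ^ p = 1)
    (n : ℕ) (hn : 1 ≤ n) (α : K →₀ ℕ) (hα : α.sum (fun _ m => m) = n)
    (red : Equiv.Perm (Fin n) → List (Fin (n - 1)))
    (hred : ∀ w, IsReducedExpression w (red w)) :
    ∃ b : Module.Basis (Equiv.Perm (Fin n) × (Fin n → ℕ) × TupleClass σ n α) F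
        (fixedPoints σ F n α),
      ∀ (w : Equiv.Perm (Fin n)) (m : Fin n → ℕ) (γ : TupleClass σ n α),
        (b (w, m, γ) : OrbitAlgebra σ F n α)
          = orbPsiWord σ F (red w) * orbYMonomial σ F m * orbClassE σ F γ := by
  have : Fintype (orbitTuples σ n α) := (finite_orbitTuples σ n α hp hσ).fintype
  let v : Equiv.Perm (Fin n) × (Fin n → ℕ) × TupleClass σ n α → fixedPoints σ F n α :=
    fun i => ⟨orbClassMonomial F σ red i, orbitSigma_orbClassMonomial i⟩
  have hli : LinearIndependent F v :=
    LinearIndependent.of_comp (fixedPoints σ F n α).subtype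
      (linearIndependent_orbClassMonomial hΓ hred)
  have hspan : ⊤ ≤ Submodule.span F (Set.range v) := by
    rintro ⟨z, hz⟩ -
    have h := mem_span_orbClassMonomial hp hσ hred hz
    have e : Set.range (orbClassMonomial (α := α) F σ red)
        = (fixedPoints σ F n α).subtype '' Set.range v := by
      rw [← Set.range_comp]
      rfl
    rw [e, ← Submodule.map_span] at h
    obtain ⟨u, hu, hu'⟩ := h
    rwa [← show u = ⟨z, hz⟩ from Subtype.ext hu']
  refine ⟨Module.Basis.mk hli hspan, fun w m γ => ?_⟩
  rw [Module.Basis.mk_apply]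
  rfl
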